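/- Let $\Lambda$ be a complete Noetherian local ring with maximal ideal $\mu$ and residue field $k$, and let $\mathcal{C}_\Lambda$ be the category of Artinian local $\Lambda$-algebras with residue field $k$. All functors $G:\mathcal{C}_\Lambda\to\mathrm{Set}$ are required to satisfy $G(k)=\bullet$ (one point). Such a $G$ is smooth if $G(B)\to G(A)$ is surjective for every surjection $B\twoheadrightarrow A$, and homogeneous if $G(B\times_A C)\to G(B)\times_{G(A)}G(C)$ is bijective for every surjection $B\twoheadrightarrow A$ and every $C\to A$. Write $G(\Lambda):=\varprojlim_n G(\Lambda/\mu^{n})$. A simplicial deformation complex (SDC) $E$ consists of smooth homogeneous functors $E^n:\mathcal{C}_\Lambda\to\mathrm{Set}$ ($n\ge 0$), natural maps $\partial^i:E^n\to E^{n+1}$ ($1\le i\le n$) and $\sigma^i:E^n\to E^{n-1}$ ($0\le i<n$), and a natural associative product $*:E^m\times E^n\to E^{m+n}$ with identity $1\in E^0$, such that $\partial^j\partial^i=\partial^i\partial^{j-1}$ for $i<j$; $\sigma^j\sigma^i=\sigma^i\sigma^{j+1}$ for $i\le j$; $\sigma^j\partial^i$ equals $\partial^i\sigma^{j-1}$ if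 $i<j$, $\mathrm{id}$ if $i=j$ or $i=j+1$, and $\partial^{i-1}\sigma^j$ if $i>j+1$; and, for $e\in E^m$, $\partial^i(e)*f=\partial^i(e*f)$, $e*\partial^i(f)=\partial^{i+m}(e*f)$, $\sigma^i(e)*f=\sigma^i(e*f)$, $e*\sigma^i(f)=\sigma^{i+m}(e*f)$. Morphisms of SDCs are families of natural transformations commuting with all this structure. Each $E^0(A)$ is then a group. Put $\mathrm{MC}_E(A)=\{\omega\in E^1(A):\omega*\omega=\partial^1(\omega)\}$, and let $\mathfrak{Def}_E(A)$ be the groupoid with objects $\mathrm{MC}_E(A)$ in which a morphism $\omega\to\omega'$ is a $g\in E^0(A)$ with $g*\omega*g^{-1}=\omega'$. Write $C^n(E)=E^n(k[\epsilon])$, where $\epsilon^2=0$. Let $\phi:E\to F$ be a morphism of SDCs such that the induced maps of tangent spaces $C^n(E)\to C^n(F)$ are surjective for all $n\ge 0$, and let $x\in \mathrm{MC}_F(\Lambda)$. Let $\mathfrak{Def}_{\phi,x}(A)$ be the groupoid with objects the pairs $(\omega,h)\in \mathrm{MC}_E(A)\times F^0(A)$ such that $h*\phi(\omega)*h^{-1}=x$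 in $F^1(A)$, in which a morphism $(\omega,h)\to(\omega',h')$ is a $g\in E^0(A)$ with $(\omega',h')=(g*\omega*g^{-1},\,h*\phi(g)^{-1})$. Let $E^n_{\phi,x}(A)$ be the fibre of $\phi:E^n(A)\to F^n(A)$ over the image of $x^n=x*\cdots*x$ (with $x^0=1$). Then the functors $E^n_{\phi,x}$, with the operations restricted from $E$, form an SDC $E_{\phi,x}$, and the canonical natural map $$\mathfrak{Def}_{E_{\phi,x}}\to\mathfrak{Def}_{\phi,x},\qquad \omega\mapsto(\omega,1),\quad g\mapsto g,$$ is an equivalence of groupoids on every $A\in\mathcal{C}_\Lambda$. -/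

import Mathlib

open CategoryTheory

universe u w

/-- Objects of the category `C_Λ`: Artinian local `Λ`-algebras whose residue field is the
residue field `k` of `Λ` (that is, `Λ → A → A/m_A` is onto). -/
structure ArtAlg (Λ : Type u) [CommRing Λ] [IsLocalRing Λ] where
  carrier : Type u
  [commRing : CommRing carrier]
  [algebra : Algebra Λ carrier]
  [isLocalRing : IsLocalRing carrier]
  [isArtinianRing : IsArtinianRing carrier]
  residue_surjective : Function.Surjective
    ((IsLocalRing.residue carrier).comp (algebraMap Λ carrier))

namespace ArtAlg

attribute [instance] commRing algebra isLocalRing isArtinianRing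

variable {Λ : Type u} [CommRing Λ] [IsLocalRing Λ]

instance : CoeSort (ArtAlg Λ) (Type u) := ⟨carrier⟩

/-- Morphisms of `C_Λ` are `Λ`-algebra homomorphisms (they are automatically local). -/
instance : Category (ArtAlg Λ) where
  Hom A B := A →ₐ[Λ] B
  id A := AlgHom.id Λ A
  comp f g := AlgHom.comp g f

/-- The ring homomorphism underlying a morphism of `C_Λ`. -/
abbrev hom {A B : ArtAlg Λ} (f : A ⟶ B) : A →ₐ[Λ] B := f

theorem isNilpotent_of_mem {A : ArtAlg Λ} {a : A} (hm : a ∈ IsLocalRing.maximalIdeal A) :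
    IsNilpotent a := by
  obtain ⟨n, hnil⟩ := (isArtinianRing_iff_isNilpotent_maximalIdeal A).1 inferInstance
  refine ⟨n, ?_⟩
  have := Ideal.pow_mem_pow hm n
  rw [hnil] at this
  simpa using this

theorem isUnit_of_isUnit_map {A B : ArtAlg Λ} (f : A →ₐ[Λ] B) (a : A) (h : IsUnit (f a)) : IsUnit a := by
  by_contra hn
  obtain ⟨n, h1⟩ := isNilpotent_of_mem (A := A) hn
  have h2 : (f a) ^ n = 0 := by rw [← map_pow, h1, map_zero]
  have h3 := h.pow n
  rw [h2] at h3
  exact not_isUnit_zero h3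

theorem algebraMap_mem {A : ArtAlg Λ} {l : Λ} (hl : l ∈ IsLocalRing.maximalIdeal Λ) :
    algebraMap Λ A l ∈ IsLocalRing.maximalIdeal A := by
  have h := RingHom.ker_isMaximal_of_surjective _ A.residue_surjective
  rw [← IsLocalRing.eq_maximalIdeal h] at hl
  rw [RingHom.mem_ker, RingHom.comp_apply, IsLocalRing.residue_eq_zero_iff] at hl
  exact hl

theorem exists_sub_mem (A : ArtAlg Λ) (a : A) :
    ∃ l : Λ, a - algebraMap Λ A l ∈ IsLocalRing.maximalIdeal A := by
  obtain ⟨l, hl⟩ := A.residue_surjective (IsLocalRing.residue A a)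
  refine ⟨l, ?_⟩
  rw [← IsLocalRing.residue_eq_zero_iff, map_sub, ← hl, RingHom.comp_apply, sub_self]

theorem residue_surjective_of {A : Type u} [CommRing A] [Algebra Λ A] [IsLocalRing A]
    (h : ∀ a : A, ∃ l : Λ, a - algebraMap Λ A l ∈ IsLocalRing.maximalIdeal A) :
    Function.Surjective ((IsLocalRing.residue A).comp (algebraMap Λ A)) := by
  intro b
  obtain ⟨a, rfl⟩ := IsLocalRing.residue_surjective b
  obtain ⟨l, hl⟩ := h a
  refine ⟨l, ?_⟩
  rw [← IsLocalRing.residue_eq_zero_iff, map_sub, sub_eq_zero] at hl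
  exact hl.symm

/-- The quotient of an object of `C_Λ` by a proper ideal. -/
def quot (A : ArtAlg Λ) (I : Ideal A) (hI : I ≠ ⊤) : ArtAlg Λ :=
  haveI : Nontrivial (A ⧸ I) := Ideal.Quotient.nontrivial_iff.2 hI
  haveI : IsLocalRing (A ⧸ I) :=
    IsLocalRing.of_surjective' (Ideal.Quotient.mk I) Ideal.Quotient.mk_surjective
  { carrier := A ⧸ I
    residue_surjective := residue_surjective_of fun b => by
      obtain ⟨a, rfl⟩ := Ideal.Quotient.mk_surjective b
      obtain ⟨l, hl⟩ := A.exists_sub_mem a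
      refine ⟨l, fun hu => hl ?_⟩
      obtain ⟨n, h1⟩ := isNilpotent_of_mem hl
      have h3 := hu.pow n
      have h4 : (Ideal.Quotient.mk I a - algebraMap Λ (A ⧸ I) l) =
        Ideal.Quotient.mk I (a - algebraMap Λ A l) := by rw [map_sub]; rfl
      rw [h4, ← map_pow, h1, map_zero] at h3
      exact absurd h3 not_isUnit_zero }

variable (Λ) in
/-- The residue field `k`, as an object of `C_Λ`. -/
noncomputable def residueField : ArtAlg Λ where
  carrier := IsLocalRing.ResidueField Λ
  residue_surjective := residue_surjective_of fun a => by
    obtain ⟨l, rfl⟩ := IsLocalRing.residue_surjective a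
    exact ⟨l, by rw [IsLocalRing.ResidueField.algebraMap_eq, sub_self]; exact zero_mem _⟩

variable (Λ) in
/-- The ring of dual numbers `k[ε]`, as an object of `C_Λ`. -/
noncomputable def dualNumbers : ArtAlg Λ :=
  haveI : Module.Finite (IsLocalRing.ResidueField Λ) (DualNumber (IsLocalRing.ResidueField Λ)) :=
    inferInstanceAs (Module.Finite (IsLocalRing.ResidueField Λ)
      (IsLocalRing.ResidueField Λ × IsLocalRing.ResidueField Λ))
  haveI : IsArtinianRing (DualNumber (IsLocalRing.ResidueField Λ)) :=
    IsArtinianRing.of_finite (IsLocalRing.ResidueField Λ) _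
  { carrier := DualNumber (IsLocalRing.ResidueField Λ)
    residue_surjective := residue_surjective_of fun a => by
      obtain ⟨l, hl⟩ := IsLocalRing.residue_surjective a.fst
      refine ⟨l, fun hu => ?_⟩
      have h1 := hu.map (TrivSqZeroExt.fstHom (IsLocalRing.ResidueField Λ)
        (IsLocalRing.ResidueField Λ) (IsLocalRing.ResidueField Λ))
      have h2 : (TrivSqZeroExt.fstHom (IsLocalRing.ResidueField Λ)
        (IsLocalRing.ResidueField Λ) (IsLocalRing.ResidueField Λ))
          (a - algebraMap Λ (DualNumber (IsLocalRing.ResidueField Λ)) l) = 0 := by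
        rw [map_sub, sub_eq_zero]
        simp only [TrivSqZeroExt.fstHom_apply, TrivSqZeroExt.algebraMap_eq_inl',
          TrivSqZeroExt.fst_inl]
        exact hl.symm
      rw [h2] at h1
      exact not_isUnit_zero h1 }

section Noetherian

variable [IsNoetherianRing Λ]

theorem finite (A : ArtAlg Λ) : Module.Finite Λ A := by
  haveI : Module.Finite Λ (A ⧸ Ring.jacobson A) := by
    rw [← Ideal.jacobson_bot, IsLocalRing.jacobson_eq_maximalIdeal ⊥ bot_ne_top]
    exact Module.Finite.of_surjective (Algebra.linearMap Λ (A ⧸ IsLocalRing.maximalIdeal A))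
      A.residue_surjective
  exact IsSemiprimaryRing.finite_of_isArtinian Λ A A

/-- The fibre product `B ×_A C` in `C_Λ`, realised as a subalgebra of `B × C`. -/
noncomputable def pullback {A B C : ArtAlg Λ} (f : B ⟶ A) (g : C ⟶ A) : ArtAlg Λ :=
  haveI : IsLocalHom (AlgHom.pullbackFst (hom f) (hom g)).toRingHom := ⟨fun p hp => by
    have h1 : IsUnit p.1.1 := hp
    have h2 : IsUnit p.1.2 := isUnit_of_isUnit_map (hom g) _ (by
      have : (hom f) p.1.1 = (hom g) p.1.2 := p.2
      rw [← this]; exact h1.map _)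
    obtain ⟨b, hb⟩ := isUnit_iff_exists_inv.1 h1
    obtain ⟨c, hc⟩ := isUnit_iff_exists_inv.1 h2
    have hbc : (hom f) b = (hom g) c := by
      have hp' : (hom f) p.1.1 = (hom g) p.1.2 := p.2
      have e1 : (hom f) p.1.1 * (hom f) b = 1 := by rw [← map_mul, hb, map_one]
      have e2 : (hom f) p.1.1 * (hom g) c = 1 := by rw [hp', ← map_mul, hc, map_one]
      exact left_inv_eq_right_inv (by rw [mul_comm]; exact e1) e2
    exact IsUnit.of_mul_eq_one ⟨(b, c), hbc⟩ (Subtype.ext (Prod.ext hb hc))⟩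
  haveI : IsLocalRing (AlgHom.pullback (hom f) (hom g)) :=
    RingHom.domain_isLocalRing (AlgHom.pullbackFst (hom f) (hom g)).toRingHom
  haveI : Module.Finite Λ (AlgHom.pullback (hom f) (hom g)) := by
    haveI := B.finite
    haveI := C.finite
    exact inferInstanceAs (Module.Finite Λ (Subalgebra.toSubmodule
      (AlgHom.pullback (hom f) (hom g))))
  haveI : IsNoetherianRing (AlgHom.pullback (hom f) (hom g)) :=
    IsNoetherianRing.of_finite Λ _
  haveI : IsArtinianRing (AlgHom.pullback (hom f) (hom g)) := by
    rw [isArtinianRing_iff_isNilpotent_maximalIdeal,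
      Ideal.FG.isNilpotent_iff_le_nilradical (IsNoetherian.noetherian _)]
    intro p hp
    have h1 : p.1.1 ∈ IsLocalRing.maximalIdeal B := fun h =>
      hp (isUnit_of_map_unit (AlgHom.pullbackFst (hom f) (hom g)).toRingHom p h)
    have h2 : p.1.2 ∈ IsLocalRing.maximalIdeal C := fun h => h1 (isUnit_of_isUnit_map (hom f) _ (by
      have hp' : (hom f) p.1.1 = (hom g) p.1.2 := p.2
      rw [hp']; exact h.map _))
    obtain ⟨m, hm⟩ := isNilpotent_of_mem h1
    obtain ⟨n, hn⟩ := isNilpotent_of_mem h2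
    refine ⟨m + n, Subtype.ext (Prod.ext ?_ ?_)⟩
    · change p.1.1 ^ (m + n) = 0
      rw [pow_add, hm, zero_mul]
    · change p.1.2 ^ (m + n) = 0
      rw [pow_add, hn, mul_zero]
  { carrier := AlgHom.pullback (hom f) (hom g)
    residue_surjective := residue_surjective_of fun p => by
      obtain ⟨l, hl⟩ := B.exists_sub_mem p.1.1
      refine ⟨l, fun hu => hl ?_⟩
      exact hu.map (AlgHom.pullbackFst (hom f) (hom g)) }

/-- The first projection `B ×_A C → B`. -/
noncomputable def fst {A B C : ArtAlg Λ} (f : B ⟶ A) (g : C ⟶ A) : pullback f g ⟶ B :=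
  AlgHom.pullbackFst (hom f) (hom g)

/-- The second projection `B ×_A C → C`. -/
noncomputable def snd {A B C : ArtAlg Λ} (f : B ⟶ A) (g : C ⟶ A) : pullback f g ⟶ C :=
  AlgHom.pullbackSnd (hom f) (hom g)

theorem condition {A B C : ArtAlg Λ} (f : B ⟶ A) (g : C ⟶ A) :
    fst f g ≫ f = snd f g ≫ g := AlgHom.ext fun p => p.2

/-- The morphism to `B ×_A C` with given components. -/
noncomputable def lift {A B C D : ArtAlg Λ} {f : B ⟶ A} {g : C ⟶ A} (b : D ⟶ B) (c : D ⟶ C)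
    (h : b ≫ f = c ≫ g) : D ⟶ pullback f g :=
  (AlgHom.prod (hom b) (hom c)).codRestrict (AlgHom.pullback (hom f) (hom g))
    (fun d => AlgHom.congr_fun h d)

theorem lift_fst {A B C D : ArtAlg Λ} {f : B ⟶ A} {g : C ⟶ A} (b : D ⟶ B) (c : D ⟶ C)
    (h : b ≫ f = c ≫ g) : lift b c h ≫ fst f g = b := rfl

theorem lift_snd {A B C D : ArtAlg Λ} {f : B ⟶ A} {g : C ⟶ A} (b : D ⟶ B) (c : D ⟶ C)
    (h : b ≫ f = c ≫ g) : lift b c h ≫ snd f g = c := rfl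

variable (Λ) in
/-- The truncation `Λ/μ^(n+1)`, as an object of `C_Λ`. -/
def trunc (n : ℕ) : ArtAlg Λ :=
  have hI : IsLocalRing.maximalIdeal Λ ^ (n + 1) ≠ ⊤ := fun h =>
    (IsLocalRing.maximalIdeal.isMaximal Λ).ne_top
      (top_unique (h ▸ Ideal.pow_le_self n.succ_ne_zero))
  haveI : Nontrivial (Λ ⧸ IsLocalRing.maximalIdeal Λ ^ (n + 1)) :=
    Ideal.Quotient.nontrivial_iff.2 hI
  haveI : IsLocalRing (Λ ⧸ IsLocalRing.maximalIdeal Λ ^ (n + 1)) :=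
    IsLocalRing.of_surjective' (Ideal.Quotient.mk _) Ideal.Quotient.mk_surjective
  haveI : IsArtinianRing (Λ ⧸ IsLocalRing.maximalIdeal Λ ^ (n + 1)) := by
    rw [isArtinianRing_iff_isNilpotent_maximalIdeal,
      Ideal.FG.isNilpotent_iff_le_nilradical (IsNoetherian.noetherian _)]
    intro a ha
    obtain ⟨l, rfl⟩ := Ideal.Quotient.mk_surjective a
    have hl : l ∈ IsLocalRing.maximalIdeal Λ := fun hu => ha (hu.map _)
    refine ⟨n + 1, ?_⟩
    rw [Ideal.zero_eq_bot, Ideal.mem_bot, ← map_pow, Ideal.Quotient.eq_zero_iff_mem]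
    exact Ideal.pow_mem_pow hl _
  { carrier := Λ ⧸ IsLocalRing.maximalIdeal Λ ^ (n + 1)
    residue_surjective := residue_surjective_of fun a => by
      obtain ⟨l, rfl⟩ := Ideal.Quotient.mk_surjective a
      exact ⟨l, by rw [Ideal.Quotient.algebraMap_eq, sub_self]; exact zero_mem _⟩ }

/-- The unique morphism `Λ/μ^(n+1) → A`, when `μ^(n+1)` maps to zero in `A`. -/
def ofTrunc (n : ℕ) (A : ArtAlg Λ)
    (h : ∀ l ∈ IsLocalRing.maximalIdeal Λ ^ (n + 1), algebraMap Λ A l = 0) : trunc Λ n ⟶ A :=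
  Ideal.Quotient.liftₐ _ (Algebra.ofId Λ A) h

theorem ofTrunc_unique {n : ℕ} {A : ArtAlg Λ} (f g : trunc Λ n ⟶ A) : f = g :=
  AlgHom.ext fun a => by
    obtain ⟨l, rfl⟩ := Ideal.Quotient.mk_surjective a
    exact ((hom f).commutes l).trans ((hom g).commutes l).symm

variable (Λ) in
/-- The reduction `Λ/μ^(n+2) → Λ/μ^(n+1)`. -/
def truncMap (n : ℕ) : trunc Λ (n + 1) ⟶ trunc Λ n :=
  ofTrunc (n + 1) (trunc Λ n) fun _ hl =>
    Ideal.Quotient.eq_zero_iff_mem.2 (Ideal.pow_le_pow_right (Nat.le_succ _) hl)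

theorem exists_pow_eq_zero (A : ArtAlg Λ) :
    ∃ n : ℕ, ∀ l ∈ IsLocalRing.maximalIdeal Λ ^ (n + 1), algebraMap Λ A l = 0 := by
  obtain ⟨n, hnil⟩ := (isArtinianRing_iff_isNilpotent_maximalIdeal A).1 inferInstance
  refine ⟨n, fun l hl => ?_⟩
  have h1 : (IsLocalRing.maximalIdeal Λ).map (algebraMap Λ A) ≤ IsLocalRing.maximalIdeal A :=
    Ideal.map_le_iff_le_comap.2 fun l hl => algebraMap_mem hl
  have h2 := Ideal.mem_map_of_mem (algebraMap Λ A) (Ideal.pow_le_pow_right (Nat.le_succ n) hl)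
  rw [Ideal.map_pow] at h2
  have h3 := Ideal.pow_right_mono h1 n h2
  rw [hnil] at h3
  simpa using h3

theorem subsingleton_of_isField {A : ArtAlg Λ} (hA : IsLocalRing.maximalIdeal A = ⊥)
    (G : ArtAlg Λ ⥤ Type w) (hG : Subsingleton (G.obj (residueField Λ))) :
    Subsingleton (G.obj A) := by
  have hs : Function.Surjective (algebraMap Λ A) := fun a => by
    obtain ⟨l, hl⟩ := A.exists_sub_mem a
    rw [hA, Ideal.mem_bot, sub_eq_zero] at hl
    exact ⟨l, hl.symm⟩
  let f : residueField Λ ⟶ A := Ideal.Quotient.liftₐ (IsLocalRing.maximalIdeal Λ)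
    (Algebra.ofId Λ A) fun l hl => by
      have := algebraMap_mem (A := A) hl
      rw [hA] at this
      simpa using this
  have hf : Function.Bijective (hom f) := by
    refine ⟨RingHom.injective (R := IsLocalRing.ResidueField Λ) (hom f).toRingHom, fun a => ?_⟩
    obtain ⟨l, rfl⟩ := hs a
    exact ⟨IsLocalRing.residue Λ l, rfl⟩
  let e := AlgEquiv.ofBijective (hom f) hf
  let g : A ⟶ residueField Λ := e.symm.toAlgHom
  have hgf : g ≫ f = 𝟙 A := AlgHom.ext fun a => e.apply_symm_apply a
  refine ⟨fun x y => ?_⟩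
  have hx : ∀ z : G.obj A, G.map f (G.map g z) = z := fun z => by
    rw [← Functor.map_comp_apply, hgf, Functor.map_id_apply]
  rw [← hx x, ← hx y, Subsingleton.elim (G.map g x) (G.map g y)]

end Noetherian

end ArtAlg

section Functors

variable {Λ : Type u} [CommRing Λ] [IsLocalRing Λ]

/-- The condition `F(k) = •`. -/
def IsPointed (F : ArtAlg Λ ⥤ Type w) : Prop :=
  Nonempty (Unique (F.obj (ArtAlg.residueField Λ)))

/-- `F` is smooth: `F(B) → F(A)` is onto for every surjection `B ↠ A` in `C_Λ`. -/
def IsSmooth (F : ArtAlg Λ ⥤ Type w) : Prop :=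
  ∀ ⦃B A : ArtAlg Λ⦄ (f : B ⟶ A), Function.Surjective (ArtAlg.hom f) →
    Function.Surjective (F.map f)

variable [IsNoetherianRing Λ]

/-- `F` is homogeneous: `F(B ×_A C) → F(B) ×_{F(A)} F(C)` is bijective for every surjection
`B ↠ A` and every `C → A`. -/
def IsHomogeneous (F : ArtAlg Λ ⥤ Type w) : Prop :=
  ∀ ⦃A B C : ArtAlg Λ⦄ (f : B ⟶ A) (g : C ⟶ A), Function.Surjective (ArtAlg.hom f) →
    Function.Bijective
      (fun p => ⟨(F.map (ArtAlg.fst f g) p, F.map (ArtAlg.snd f g) p), by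
          rw [← Functor.map_comp_apply, ← Functor.map_comp_apply, ArtAlg.condition]⟩ :
        F.obj (ArtAlg.pullback f g) → {q : F.obj B × F.obj C // F.map f q.1 = F.map g q.2})

theorem IsHomogeneous.ext {F : ArtAlg Λ ⥤ Type w} (hF : IsHomogeneous F) {A B C : ArtAlg Λ}
    {f : B ⟶ A} {g : C ⟶ A} (hf : Function.Surjective (ArtAlg.hom f))
    {p q : F.obj (ArtAlg.pullback f g)} (h1 : F.map (ArtAlg.fst f g) p = F.map (ArtAlg.fst f g) q)
    (h2 : F.map (ArtAlg.snd f g) p = F.map (ArtAlg.snd f g) q) : p = q :=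
  (hF f g hf).1 (Subtype.ext (Prod.ext h1 h2))

theorem IsHomogeneous.exists_glue {F : ArtAlg Λ ⥤ Type w} (hF : IsHomogeneous F)
    {A B C : ArtAlg Λ} {f : B ⟶ A} {g : C ⟶ A} (hf : Function.Surjective (ArtAlg.hom f))
    (b : F.obj B) (c : F.obj C) (h : F.map f b = F.map g c) :
    ∃ p : F.obj (ArtAlg.pullback f g),
      F.map (ArtAlg.fst f g) p = b ∧ F.map (ArtAlg.snd f g) p = c := by
  obtain ⟨p, hp⟩ := (hF f g hf).2 ⟨(b, c), h⟩
  exact ⟨p, congrArg (fun q => q.1.1) hp, congrArg (fun q => q.1.2) hp⟩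

/-- If `I = ker (B → A)` has square zero, `(a, b, c) ↦ a - b + c` is a ring homomorphism
`B ×_A B ×_A B → B`. -/
noncomputable def heapHom {A B : ArtAlg Λ} (f : B ⟶ A)
    (hI : ∀ a b : B, ArtAlg.hom f a = 0 → ArtAlg.hom f b = 0 → a * b = 0) :
    ArtAlg.pullback (ArtAlg.fst f f ≫ f) f ⟶ B :=
  let q : ArtAlg.pullback (ArtAlg.fst f f ≫ f) f → B :=
    fun t => t.1.1.1.1 - t.1.1.1.2 + t.1.2
  { toFun := q
    map_one' := by
      change (1 : B) - 1 + 1 = 1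
      ring
    map_zero' := by
      change (0 : B) - 0 + 0 = 0
      ring
    map_add' := fun s t => by
      change (s.1.1.1.1 + t.1.1.1.1 : B) - (s.1.1.1.2 + t.1.1.1.2) + (s.1.2 + t.1.2) =
        (s.1.1.1.1 - s.1.1.1.2 + s.1.2) + (t.1.1.1.1 - t.1.1.1.2 + t.1.2)
      ring
    map_mul' := fun s t => by
      change (s.1.1.1.1 * t.1.1.1.1 : B) - (s.1.1.1.2 * t.1.1.1.2) + (s.1.2 * t.1.2) =
        (s.1.1.1.1 - s.1.1.1.2 + s.1.2) * (t.1.1.1.1 - t.1.1.1.2 + t.1.2)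
      have key : ∀ r : ArtAlg.pullback (ArtAlg.fst f f ≫ f) f,
          ArtAlg.hom f (r.1.1.1.1 - r.1.1.1.2) = 0 ∧ ArtAlg.hom f (r.1.2 - r.1.1.1.2) = 0 := by
        intro r
        have e1 : ArtAlg.hom f r.1.1.1.1 = ArtAlg.hom f r.1.1.1.2 := r.1.1.2
        have e2 : ArtAlg.hom f r.1.1.1.1 = ArtAlg.hom f r.1.2 := r.2
        rw [map_sub, map_sub, ← e2, e1]
        simp
      have k1 := hI _ _ (key s).1 (key t).2
      have k2 := hI _ _ (key s).2 (key t).1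
      linear_combination - k1 - k2
    commutes' := fun r => by
      change (algebraMap Λ B r) - (algebraMap Λ B r) + (algebraMap Λ B r) = algebraMap Λ B r
      ring }

/-- A smooth homogeneous pointed functor in monoids takes values in groups. -/
theorem isUnit_of_smooth (G : ArtAlg Λ ⥤ Type w) [inst : ∀ A, Monoid (G.obj A)]
    (hmul : ∀ {A B : ArtAlg Λ} (f : A ⟶ B) (a b : G.obj A),
      G.map f (a * b) = G.map f a * G.map f b)
    (hone : ∀ {A B : ArtAlg Λ} (f : A ⟶ B), G.map f 1 = 1)
    (h0 : IsPointed G) (hs : IsSmooth G) (hh : IsHomogeneous G) (A : ArtAlg Λ) (g : G.obj A) :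
    IsUnit g := by
  -- square-zero step
  have step : ∀ {A B : ArtAlg Λ} (f : B ⟶ A), Function.Surjective (ArtAlg.hom f) →
      (∀ a b : B, ArtAlg.hom f a = 0 → ArtAlg.hom f b = 0 → a * b = 0) →
      ∀ u : G.obj B, G.map f u = 1 → IsUnit u := by
    intro A B f hf hI u hu
    have hf2 : Function.Surjective (ArtAlg.hom (ArtAlg.fst f f ≫ f)) := by
      intro a
      obtain ⟨b, rfl⟩ := hf a
      exact ⟨⟨(b, b), rfl⟩, rfl⟩
    let P := ArtAlg.pullback f f
    let p1 : P ⟶ B := ArtAlg.fst f f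
    let p2 : P ⟶ B := ArtAlg.snd f f
    let T := ArtAlg.pullback (p1 ≫ f) f
    let q : T ⟶ P := ArtAlg.fst (p1 ≫ f) f
    let q3 : T ⟶ B := ArtAlg.snd (p1 ≫ f) f
    let t : T ⟶ B := heapHom f hI
    -- the element `(1, u, 1)`
    obtain ⟨e', he1, he2⟩ := hh.exists_glue (f := f) (g := f) hf 1 u (by rw [hone, hu])
    obtain ⟨e, he, he3⟩ := hh.exists_glue (f := p1 ≫ f) (g := f) hf2 e' 1
      (by rw [Functor.map_comp_apply, he1])
    -- the element `(1, u)`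
    let s1 : P ⟶ T := ArtAlg.lift (ArtAlg.lift p1 p1 rfl) p2 (ArtAlg.condition f f)
    let s2 : P ⟶ T := ArtAlg.lift (ArtAlg.lift p1 p2 (ArtAlg.condition f f)) p2
      (ArtAlg.condition f f)
    have t1 : s1 ≫ t = p2 := AlgHom.ext fun x => by
      change (x.1.1 : B) - x.1.1 + x.1.2 = x.1.2
      ring
    have t2 : s2 ≫ t = p1 := AlgHom.ext fun x => by
      change (x.1.1 : B) - x.1.2 + x.1.2 = x.1.1
      ring
    have c1 : G.map q (G.map s1 e') = 1 := by
      rw [← Functor.map_comp_apply]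
      refine hh.ext (f := f) (g := f) hf ?_ ?_
      · rw [← Functor.map_comp_apply, hone]; exact he1
      · rw [← Functor.map_comp_apply, hone]; exact he1
    have c2 : G.map q3 (G.map s1 e') = u := by
      rw [← Functor.map_comp_apply]; exact he2
    have d1 : G.map q (G.map s2 e') = e' := by
      rw [← Functor.map_comp_apply]
      refine hh.ext (f := f) (g := f) hf ?_ ?_
      · rw [← Functor.map_comp_apply]; rfl
      · rw [← Functor.map_comp_apply]; rfl
    have d2 : G.map q3 (G.map s2 e') = u := by
      rw [← Functor.map_comp_apply]; exact he2
    have m1 : e * G.map s1 e' = G.map s2 e' := by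
      refine hh.ext (f := p1 ≫ f) (g := f) hf2 ?_ ?_
      · rw [hmul]
        change G.map q e * G.map q (G.map s1 e') = G.map q (G.map s2 e')
        rw [c1, d1, mul_one]; exact he
      · rw [hmul]
        change G.map q3 e * G.map q3 (G.map s1 e') = G.map q3 (G.map s2 e')
        rw [c2, d2]
        rw [show G.map q3 e = 1 from he3, one_mul]
    have m2 : G.map s1 e' * e = G.map s2 e' := by
      refine hh.ext (f := p1 ≫ f) (g := f) hf2 ?_ ?_
      · rw [hmul]
        change G.map q (G.map s1 e') * G.map q e = G.map q (G.map s2 e')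
        rw [c1, d1, one_mul]; exact he
      · rw [hmul]
        change G.map q3 (G.map s1 e') * G.map q3 e = G.map q3 (G.map s2 e')
        rw [c2, d2]
        rw [show G.map q3 e = 1 from he3, mul_one]
    have v1 : G.map t (G.map s1 e') = u := by
      rw [← Functor.map_comp_apply, t1]; exact he2
    have v2 : G.map t (G.map s2 e') = 1 := by
      rw [← Functor.map_comp_apply, t2]; exact he1
    refine ⟨⟨u, G.map t e, ?_, ?_⟩, rfl⟩
    · rw [← v2, ← m2, hmul, v1]
    · rw [← v2, ← m1, hmul, v1]
  have main : ∀ (n : ℕ) (A : ArtAlg Λ), IsLocalRing.maximalIdeal A ^ (n + 1) = ⊥ →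
      ∀ g : G.obj A, IsUnit g := by
    intro n
    induction n with
    | zero =>
      intro A hA g
      obtain ⟨hU⟩ := h0
      haveI := ArtAlg.subsingleton_of_isField (A := A) (by simpa using hA) G inferInstance
      rw [Subsingleton.elim g 1]
      exact isUnit_one
    | succ n ih =>
      intro A hA g
      have hI : IsLocalRing.maximalIdeal A ^ (n + 1) ≠ ⊤ := fun h =>
        (IsLocalRing.maximalIdeal.isMaximal A).ne_top
          (top_unique (h ▸ Ideal.pow_le_self n.succ_ne_zero))
      let Q := A.quot _ hI
      let π : A ⟶ Q := Ideal.Quotient.mkₐ Λ _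
      have hπ : Function.Surjective (ArtAlg.hom π) := Ideal.Quotient.mk_surjective
      have hker : ∀ a : A, ArtAlg.hom π a = 0 → a ∈ IsLocalRing.maximalIdeal A ^ (n + 1) :=
        fun a ha => Ideal.Quotient.eq_zero_iff_mem.1 ha
      have hQ : IsLocalRing.maximalIdeal Q ^ (n + 1) = ⊥ := by
        have h1 : IsLocalRing.maximalIdeal Q ≤
            (IsLocalRing.maximalIdeal A).map (ArtAlg.hom π).toRingHom := by
          intro b hb
          obtain ⟨a, rfl⟩ := hπ b
          exact Ideal.mem_map_of_mem (ArtAlg.hom π).toRingHom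
            (show a ∈ IsLocalRing.maximalIdeal A from fun hu => hb (hu.map _))
        refine le_bot_iff.1 ((Ideal.pow_right_mono h1 (n + 1)).trans ?_)
        rw [← Ideal.map_pow, Ideal.map_le_iff_le_comap]
        intro a ha
        exact Ideal.Quotient.eq_zero_iff_mem.2 ha
      have hsq : ∀ a b : A, ArtAlg.hom π a = 0 → ArtAlg.hom π b = 0 → a * b = 0 := by
        intro a b ha hb
        have h1 := Ideal.mul_mem_mul (hker a ha) (hker b hb)
        rw [← pow_add] at h1
        have h2 := Ideal.pow_le_pow_right (I := IsLocalRing.maximalIdeal A)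
          (show n + 1 + 1 ≤ n + 1 + (n + 1) by omega) h1
        rw [hA] at h2
        simpa using h2
      obtain ⟨h', hh1, hh2⟩ := isUnit_iff_exists.1 (ih Q hQ (G.map π g))
      obtain ⟨h, rfl⟩ := hs π hπ h'
      obtain ⟨a, ha, -⟩ := isUnit_iff_exists.1 (step π hπ hsq (g * h) (by rw [hmul, hh1]))
      obtain ⟨b, -, hb⟩ := isUnit_iff_exists.1 (step π hπ hsq (h * g) (by rw [hmul, hh2]))
      have e1 : g * (h * a) = 1 := by rw [← mul_assoc]; exact ha
      have e2 : (b * h) * g = 1 := by rw [mul_assoc]; exact hb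
      exact isUnit_iff_exists.2 ⟨h * a, e1, by rw [← left_inv_eq_right_inv e2 e1]; exact e2⟩
  obtain ⟨n, hn⟩ := (isArtinianRing_iff_isNilpotent_maximalIdeal A).1 inferInstance
  refine main n A ?_ g
  rw [pow_succ, hn]
  simp

end Functors

section ProLimit

variable {Λ : Type u} [CommRing Λ] [IsLocalRing Λ] [IsNoetherianRing Λ]

/-- The value `F(Λ) := lim F(Λ/μ^(n+1))` of a functor on `C_Λ` at the complete ring `Λ`. -/
def ProLimit (F : ArtAlg Λ ⥤ Type w) : Type w :=
  {x : ∀ n : ℕ, F.obj (ArtAlg.trunc Λ n) // ∀ n, F.map (ArtAlg.truncMap Λ n) (x (n + 1)) = x n}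

open Classical in
/-- The image of `x ∈ F(Λ)` in `F(A)`, induced by `Λ/μ^(n+1) → A` for `n` large. -/
noncomputable def ProLimit.eval {F : ArtAlg Λ ⥤ Type w} (x : ProLimit F) (A : ArtAlg Λ) :
    F.obj A :=
  F.map (ArtAlg.ofTrunc (Nat.find A.exists_pow_eq_zero) A (Nat.find_spec A.exists_pow_eq_zero))
    (x.1 _)

theorem ProLimit.map_ofTrunc {F : ArtAlg Λ ⥤ Type w} (x : ProLimit F) {A : ArtAlg Λ} {n : ℕ}
    (f : ArtAlg.trunc Λ n ⟶ A) : F.map f (x.1 n) = x.eval A := by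
  classical
  have h1 : ∀ l ∈ IsLocalRing.maximalIdeal Λ ^ (n + 1), algebraMap Λ A l = 0 := fun l hl => by
    have h2 : algebraMap Λ (ArtAlg.trunc Λ n) l = 0 := Ideal.Quotient.eq_zero_iff_mem.2 hl
    rw [← (ArtAlg.hom f).commutes, h2, map_zero]
  have h2 : ∀ n, Nat.find A.exists_pow_eq_zero ≤ n → ∀ f : ArtAlg.trunc Λ n ⟶ A,
      F.map f (x.1 n) = x.eval A := by
    intro n hn
    induction n, hn using Nat.le_induction with
    | base => intro f; rw [ArtAlg.ofTrunc_unique f]; rfl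
    | succ n hn ih =>
      intro f
      let g : ArtAlg.trunc Λ n ⟶ A := ArtAlg.ofTrunc n A fun l hl =>
        Nat.find_spec A.exists_pow_eq_zero l
          (Ideal.pow_le_pow_right (Nat.succ_le_succ hn) hl)
      rw [ArtAlg.ofTrunc_unique f (ArtAlg.truncMap Λ n ≫ g), Functor.map_comp_apply, x.2, ih]
  exact h2 n (Nat.find_min' _ h1) f

theorem ProLimit.map_eval {F : ArtAlg Λ ⥤ Type w} (x : ProLimit F) {A B : ArtAlg Λ}
    (f : A ⟶ B) : F.map f (x.eval A) = x.eval B := by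
  rw [ProLimit.eval, ← Functor.map_comp_apply, x.map_ofTrunc]

end ProLimit

/-- The data underlying a simplicial deformation complex. The coface `∂^i : E^n → E^(n+1)` is
given for `1 ≤ i ≤ n` and the codegeneracy `σ^i : E^(n+1) → E^n` for `0 ≤ i ≤ n`. The product
`E^m × E^n → E^(m+n)` takes a proof of `m + n = p` and lands in `E^p`, so that associativity and
the other laws can be stated without transport along equalities of degrees. -/
structure PreSDC (Λ : Type u) [CommRing Λ] [IsLocalRing Λ] where
  obj : ℕ → ArtAlg Λ ⥤ Type w
  d (n i : ℕ) (h1 : 1 ≤ i) (h2 : i ≤ n) : obj n ⟶ obj (n + 1)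
  s (n i : ℕ) (h : i < n + 1) : obj (n + 1) ⟶ obj n
  mul {m n p : ℕ} (h : m + n = p) {A : ArtAlg Λ} (e : (obj m).obj A) (f : (obj n).obj A) :
    (obj p).obj A
  one (A : ArtAlg Λ) : (obj 0).obj A
  map_mul {m n p : ℕ} (h : m + n = p) {A B : ArtAlg Λ} (g : A ⟶ B) (e : (obj m).obj A)
    (f : (obj n).obj A) :
    (obj p).map g (mul h e f) = mul h ((obj m).map g e) ((obj n).map g f)
  map_one {A B : ArtAlg Λ} (g : A ⟶ B) : (obj 0).map g (one A) = one B

/-- The axioms of a simplicial deformation complex. -/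
structure IsSDC {Λ : Type u} [CommRing Λ] [IsLocalRing Λ] [IsNoetherianRing Λ]
    (E : PreSDC.{u, w} Λ) : Prop where
  pointed (n : ℕ) : IsPointed (E.obj n)
  smooth (n : ℕ) : IsSmooth (E.obj n)
  homogeneous (n : ℕ) : IsHomogeneous (E.obj n)
  mul_assoc {l m n lm mn p : ℕ} (h1 : l + m = lm) (h2 : lm + n = p) (h3 : m + n = mn)
    (h4 : l + mn = p) {A : ArtAlg Λ} (a : (E.obj l).obj A) (b : (E.obj m).obj A)
    (c : (E.obj n).obj A) : E.mul h2 (E.mul h1 a b) c = E.mul h4 a (E.mul h3 b c)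
  one_mul {n : ℕ} (h : 0 + n = n) {A : ArtAlg Λ} (e : (E.obj n).obj A) :
    E.mul h (E.one A) e = e
  mul_one {n : ℕ} (h : n + 0 = n) {A : ArtAlg Λ} (e : (E.obj n).obj A) :
    E.mul h e (E.one A) = e
  /-- `∂^j ∂^i = ∂^i ∂^(j-1)` for `i < j`, with `j` written as `j + 1`. -/
  d_d {n i j : ℕ} (hi : 1 ≤ i) (hij : i ≤ j) (hj : j ≤ n) {A : ArtAlg Λ}
    (e : (E.obj n).obj A) :
    (E.d (n + 1) (j + 1) (by omega) (by omega)).app A ((E.d n i hi (by omega)).app A e) =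
      (E.d (n + 1) i hi (by omega)).app A ((E.d n j (by omega) hj).app A e)
  /-- `σ^j σ^i = σ^i σ^(j+1)` for `i ≤ j`. -/
  s_s {n i j : ℕ} (hij : i ≤ j) (hj : j < n + 1) {A : ArtAlg Λ} (e : (E.obj (n + 2)).obj A) :
    (E.s n j hj).app A ((E.s (n + 1) i (by omega)).app A e) =
      (E.s n i (by omega)).app A ((E.s (n + 1) (j + 1) (by omega)).app A e)
  /-- `σ^j ∂^i = ∂^i σ^(j-1)` for `i < j`, with `j` written as `j + 1`. -/
  s_d_lt {n i j : ℕ} (hi : 1 ≤ i) (hij : i ≤ j) (hj : j ≤ n) {A : ArtAlg Λ}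
    (e : (E.obj (n + 1)).obj A) :
    (E.s (n + 1) (j + 1) (by omega)).app A ((E.d (n + 1) i hi (by omega)).app A e) =
      (E.d n i hi (by omega)).app A ((E.s n j (by omega)).app A e)
  /-- `σ^j ∂^i = id` for `i = j` or `i = j + 1`. -/
  s_d_eq {n i j : ℕ} (hi : 1 ≤ i) (hn : i ≤ n) (hij : i = j ∨ i = j + 1) {A : ArtAlg Λ}
    (e : (E.obj n).obj A) :
    (E.s n j (by omega)).app A ((E.d n i hi hn).app A e) = e
  /-- `σ^j ∂^i = ∂^(i-1) σ^j` for `i > j + 1`, with `i` written as `i + 1`. -/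
  s_d_gt {n i j : ℕ} (hij : j < i) (hi : i ≤ n) {A : ArtAlg Λ} (e : (E.obj (n + 1)).obj A) :
    (E.s (n + 1) j (by omega)).app A ((E.d (n + 1) (i + 1) (by omega) (by omega)).app A e) =
      (E.d n i (by omega) hi).app A ((E.s n j (by omega)).app A e)
  /-- `∂^i(e) * f = ∂^i(e * f)`. -/
  d_mul {m n p i : ℕ} (hi : 1 ≤ i) (hm : i ≤ m) (h : m + n = p) {A : ArtAlg Λ}
    (e : (E.obj m).obj A) (f : (E.obj n).obj A) :
    E.mul (show m + 1 + n = p + 1 by omega) ((E.d m i hi hm).app A e) f =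
      (E.d p i hi (by omega)).app A (E.mul h e f)
  /-- `e * ∂^i(f) = ∂^(i+m)(e * f)` for `e ∈ E^m`. -/
  mul_d {m n p i : ℕ} (hi : 1 ≤ i) (hn : i ≤ n) (h : m + n = p) {A : ArtAlg Λ}
    (e : (E.obj m).obj A) (f : (E.obj n).obj A) :
    E.mul (show m + (n + 1) = p + 1 by omega) e ((E.d n i hi hn).app A f) =
      (E.d p (i + m) (by omega) (by omega)).app A (E.mul h e f)
  /-- `σ^i(e) * f = σ^i(e * f)`. -/
  s_mul {m n p i : ℕ} (hi : i < m + 1) (h : m + n = p) {A : ArtAlg Λ}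
    (e : (E.obj (m + 1)).obj A) (f : (E.obj n).obj A) :
    E.mul h ((E.s m i hi).app A e) f =
      (E.s p i (by omega)).app A (E.mul (show m + 1 + n = p + 1 by omega) e f)
  /-- `e * σ^i(f) = σ^(i+m)(e * f)` for `e ∈ E^m`. -/
  mul_s {m n p i : ℕ} (hi : i < n + 1) (h : m + n = p) {A : ArtAlg Λ}
    (e : (E.obj m).obj A) (f : (E.obj (n + 1)).obj A) :
    E.mul h e ((E.s n i hi).app A f) =
      (E.s p (i + m) (by omega)).app A (E.mul (show m + (n + 1) = p + 1 by omega) e f)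

/-- A simplicial deformation complex (SDC) over `Λ`. -/
structure SDC (Λ : Type u) [CommRing Λ] [IsLocalRing Λ] [IsNoetherianRing Λ]
    extends PreSDC.{u, w} Λ where
  isSDC : IsSDC toPreSDC

/-- A morphism of SDCs: natural transformations `E^n → F^n` commuting with all operations. -/
structure PreSDC.Hom {Λ : Type u} [CommRing Λ] [IsLocalRing Λ] (E F : PreSDC.{u, w} Λ) where
  app (n : ℕ) : E.obj n ⟶ F.obj n
  map_d {n i : ℕ} (h1 : 1 ≤ i) (h2 : i ≤ n) {A : ArtAlg Λ} (e : (E.obj n).obj A) :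
    (app (n + 1)).app A ((E.d n i h1 h2).app A e) = (F.d n i h1 h2).app A ((app n).app A e)
  map_s {n i : ℕ} (h : i < n + 1) {A : ArtAlg Λ} (e : (E.obj (n + 1)).obj A) :
    (app n).app A ((E.s n i h).app A e) = (F.s n i h).app A ((app (n + 1)).app A e)
  map_mul {m n p : ℕ} (h : m + n = p) {A : ArtAlg Λ} (e : (E.obj m).obj A)
    (f : (E.obj n).obj A) :
    (app p).app A (E.mul h e f) = F.mul h ((app m).app A e) ((app n).app A f)
  map_one (A : ArtAlg Λ) : (app 0).app A (E.one A) = F.one A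

namespace PreSDC

variable {Λ : Type u} [CommRing Λ] [IsLocalRing Λ]

/-- The tangent space `C^n(E) = E^n(k[ε])`. -/
abbrev tangent (E : PreSDC.{u, w} Λ) (n : ℕ) : Type w := (E.obj n).obj (ArtAlg.dualNumbers Λ)

/-- The map `C^n(E) → C^n(F)` induced by a morphism of SDCs. -/
noncomputable def Hom.tangentMap {E F : PreSDC.{u, w} Λ} (φ : E.Hom F) (n : ℕ) : E.tangent n → F.tangent n :=
  fun v => (φ.app n).app (ArtAlg.dualNumbers Λ) v

/-- The power `e^n = e * ⋯ * e ∈ E^n(A)` of `e ∈ E^1(A)`. -/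
def pow (E : PreSDC.{u, w} Λ) {A : ArtAlg Λ} (e : (E.obj 1).obj A) : ∀ n : ℕ, (E.obj n).obj A
  | 0 => E.one A
  | n + 1 => E.mul rfl (E.pow e n) e

theorem map_pow (E : PreSDC.{u, w} Λ) {A B : ArtAlg Λ} (g : A ⟶ B) (e : (E.obj 1).obj A) (n : ℕ) :
    (E.obj n).map g (E.pow e n) = E.pow ((E.obj 1).map g e) n := by
  induction n with
  | zero => exact E.map_one g
  | succ n ih => rw [pow, E.map_mul, ih, pow]

/-- The Maurer–Cartan equation `ω * ω = ∂^1(ω)` for `ω ∈ E^1(A)`. -/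
def IsMC (E : PreSDC.{u, w} Λ) {A : ArtAlg Λ} (ω : (E.obj 1).obj A) : Prop :=
  E.mul (rfl : 1 + 1 = 1 + 1) ω ω = (E.d 1 1 le_rfl le_rfl).app A ω

theorem IsMC.map {E : PreSDC.{u, w} Λ} {A B : ArtAlg Λ} {ω : (E.obj 1).obj A} (h : E.IsMC ω)
    (f : A ⟶ B) : E.IsMC ((E.obj 1).map f ω) := by
  rw [IsMC, ← E.map_mul, h]
  exact (NatTrans.naturality_apply (E.d 1 1 le_rfl le_rfl) f ω).symm

/-- The Maurer–Cartan functor `MC_E(A) = {ω ∈ E^1(A) : ω * ω = ∂^1(ω)}`. -/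
def mc (E : PreSDC.{u, w} Λ) : ArtAlg Λ ⥤ Type w where
  obj A := {ω : (E.obj 1).obj A // E.IsMC ω}
  map f := TypeCat.ofHom fun ω => ⟨(E.obj 1).map f ω.1, ω.2.map f⟩
  map_id A := ConcreteCategory.hom_ext _ _ fun ω =>
    Subtype.ext (Functor.map_id_apply (E.obj 1) A ω.1)
  map_comp f g := ConcreteCategory.hom_ext _ _ fun ω =>
    Subtype.ext (Functor.map_comp_apply (E.obj 1) f g ω.1)

/-- The element `x_A ∈ E^1(A)` determined by `x ∈ MC_E(Λ)`. -/
noncomputable def mcAt [IsNoetherianRing Λ] {E : PreSDC.{u, w} Λ} (x : ProLimit E.mc)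
    (A : ArtAlg Λ) : (E.obj 1).obj A :=
  (x.eval A).1

theorem isMC_mcAt [IsNoetherianRing Λ] {E : PreSDC.{u, w} Λ} (x : ProLimit E.mc)
    (A : ArtAlg Λ) : E.IsMC (mcAt x A) :=
  (x.eval A).2

theorem map_mcAt [IsNoetherianRing Λ] {E : PreSDC.{u, w} Λ} (x : ProLimit E.mc)
    {A B : ArtAlg Λ} (f : A ⟶ B) : (E.obj 1).map f (mcAt x A) = mcAt x B :=
  congrArg Subtype.val (x.map_eval f)

end PreSDC

namespace SDC

variable {Λ : Type u} [CommRing Λ] [IsLocalRing Λ] [IsNoetherianRing Λ]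

/-- `E^0(A)` is a monoid under the product. -/
instance monoid (E : SDC.{u, w} Λ) (A : ArtAlg Λ) : Monoid ((E.obj 0).obj A) where
  mul g h := E.mul (rfl : 0 + 0 = 0) g h
  mul_assoc a b c := E.isSDC.mul_assoc _ _ _ _ a b c
  one := E.one A
  one_mul a := E.isSDC.one_mul _ a
  mul_one a := E.isSDC.mul_one _ a

theorem isUnit (E : SDC.{u, w} Λ) {A : ArtAlg Λ} (g : (E.obj 0).obj A) : IsUnit g :=
  isUnit_of_smooth (E.obj 0) (fun f a b => E.map_mul rfl f a b) (fun f => E.map_one f)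
    (E.isSDC.pointed 0) (E.isSDC.smooth 0) (E.isSDC.homogeneous 0) A g

/-- `E^0(A)` is a group under the product. -/
noncomputable instance group (E : SDC.{u, w} Λ) (A : ArtAlg Λ) : Group ((E.obj 0).obj A) where
  inv g := ((E.isUnit g).unit⁻¹ : ((E.obj 0).obj A)ˣ)
  inv_mul_cancel g := (E.isUnit g).val_inv_mul

theorem mul_def (E : SDC.{u, w} Λ) {A : ArtAlg Λ} (g h : (E.obj 0).obj A) :
    E.mul (rfl : 0 + 0 = 0) g h = g * h := rfl

/-- The map `E^0(A) → E^0(B)` induced by `A → B`, as a group homomorphism. -/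
def mapGauge (E : SDC.{u, w} Λ) {A B : ArtAlg Λ} (f : A ⟶ B) :
    (E.obj 0).obj A →* (E.obj 0).obj B where
  toFun g := (E.obj 0).map f g
  map_one' := E.map_one f
  map_mul' a b := E.map_mul rfl f a b

/-- The map `E^0(A) → F^0(A)` induced by a morphism of SDCs, as a group homomorphism. -/
def homGauge {E F : SDC.{u, w} Λ} (φ : E.Hom F.toPreSDC) (A : ArtAlg Λ) :
    (E.obj 0).obj A →* (F.obj 0).obj A where
  toFun g := (φ.app 0).app A g
  map_one' := φ.map_one A
  map_mul' a b := φ.map_mul rfl a b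

/-- The adjoint action `g * ω * g⁻¹` of `g ∈ E^0(A)` on `ω ∈ E^1(A)`. -/
noncomputable def conj (E : SDC.{u, w} Λ) {A : ArtAlg Λ} (g : (E.obj 0).obj A)
    (ω : (E.obj 1).obj A) : (E.obj 1).obj A :=
  E.mul (rfl : 1 + 0 = 1) (E.mul (rfl : 0 + 1 = 1) g ω) g⁻¹

theorem conj_one (E : SDC.{u, w} Λ) {A : ArtAlg Λ} (ω : (E.obj 1).obj A) : E.conj 1 ω = ω := by
  rw [conj, inv_one]
  exact (E.isSDC.mul_one _ _).trans (E.isSDC.one_mul _ _)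

theorem conj_conj (E : SDC.{u, w} Λ) {A : ArtAlg Λ} (g h : (E.obj 0).obj A)
    (ω : (E.obj 1).obj A) : E.conj g (E.conj h ω) = E.conj (g * h) ω := by
  rw [conj, conj, conj, mul_inv_rev, ← mul_def, ← mul_def,
    E.isSDC.mul_assoc (rfl : 0 + 0 = 0) (rfl : 0 + 1 = 1) (rfl : 0 + 1 = 1) (rfl : 0 + 1 = 1),
    ← E.isSDC.mul_assoc (rfl : 1 + 0 = 1) (rfl : 1 + 0 = 1) (rfl : 0 + 0 = 0) (rfl : 1 + 0 = 1),
    ← E.isSDC.mul_assoc (rfl : 0 + 1 = 1) (rfl : 1 + 0 = 1) (rfl : 1 + 0 = 1) (rfl : 0 + 1 = 1)]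

theorem conj_inv (E : SDC.{u, w} Λ) {A : ArtAlg Λ} {g : (E.obj 0).obj A}
    {ω ω' : (E.obj 1).obj A} (h : E.conj g ω = ω') : E.conj g⁻¹ ω' = ω := by
  rw [← h, conj_conj, inv_mul_cancel, conj_one]

theorem map_conj (E : SDC.{u, w} Λ) {A B : ArtAlg Λ} (f : A ⟶ B) (g : (E.obj 0).obj A)
    (ω : (E.obj 1).obj A) :
    (E.obj 1).map f (E.conj g ω) = E.conj (E.mapGauge f g) ((E.obj 1).map f ω) := by
  rw [conj, E.map_mul, E.map_mul, conj, ← _root_.map_inv]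
  rfl

theorem hom_conj {E F : SDC.{u, w} Λ} (φ : E.Hom F.toPreSDC) {A : ArtAlg Λ} (g : (E.obj 0).obj A)
    (ω : (E.obj 1).obj A) :
    (φ.app 1).app A (E.conj g ω) = F.conj (homGauge φ A g) ((φ.app 1).app A ω) := by
  rw [conj, φ.map_mul, φ.map_mul, conj, ← _root_.map_inv]
  rfl

theorem pow_add (E : SDC.{u, w} Λ) {A : ArtAlg Λ} (e : (E.obj 1).obj A) {m n p : ℕ}
    (h : m + n = p) : E.mul h (E.pow e m) (E.pow e n) = E.pow e p := by
  induction n generalizing p with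
  | zero => obtain rfl : m = p := h; exact E.isSDC.mul_one _ _
  | succ n ih =>
    obtain rfl : m + n + 1 = p := h
    rw [PreSDC.pow]
    refine (E.isSDC.mul_assoc rfl rfl rfl rfl _ _ _).symm.trans ?_
    rw [ih, PreSDC.pow]

theorem s_mc (E : SDC.{u, w} Λ) {A : ArtAlg Λ} {ω : (E.obj 1).obj A} (hω : E.IsMC ω) :
    (E.s 0 0 Nat.one_pos).app A ω = E.one A := by
  have h1 : E.mul (rfl : 0 + 1 = 0 + 1) ((E.s 0 0 Nat.one_pos).app A ω) ω = ω := by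
    rw [E.isSDC.s_mul]
    have h2 := E.isSDC.s_d_eq (n := 1) (i := 1) (j := 0) le_rfl le_rfl (Or.inr rfl) ω
    rw [← show _ = _ from hω] at h2
    exact h2
  have h3 := E.isSDC.mul_s (m := 0) (n := 0) (i := 0) Nat.one_pos (rfl : 0 + 0 = 0)
    ((E.s 0 0 Nat.one_pos).app A ω) ω
  rw [h1] at h3
  exact mul_eq_left.1 (show (E.s 0 0 Nat.one_pos).app A ω * (E.s 0 0 Nat.one_pos).app A ω =
    (E.s 0 0 Nat.one_pos).app A ω from h3)

theorem d_pow (E : SDC.{u, w} Λ) {A : ArtAlg Λ} {ω : (E.obj 1).obj A} (hω : E.IsMC ω) {n i : ℕ} (h1 : 1 ≤ i)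
    (h2 : i ≤ n) : (E.d n i h1 h2).app A (E.pow ω n) = E.pow ω (n + 1) := by
  obtain ⟨a, rfl⟩ := Nat.exists_eq_add_of_le' h1
  obtain ⟨b, rfl⟩ := Nat.exists_eq_add_of_le h2
  have e1 : E.pow ω 1 = ω := E.isSDC.one_mul _ _
  have e2 : E.pow ω 2 = (E.d 1 1 le_rfl le_rfl).app A ω := by
    rw [PreSDC.pow, e1]; exact hω
  rw [← E.pow_add ω (show a + (1 + b) = a + 1 + b by omega), ← E.pow_add ω (rfl : 1 + b = _)]
  have e3 := E.isSDC.mul_d (m := a) (n := 1 + b) (p := a + 1 + b) (i := 1) le_rfl (by omega)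
    (by omega) (E.pow ω a) (E.mul rfl (E.pow ω 1) (E.pow ω b))
  have e4 := E.isSDC.d_mul (m := 1) (n := b) (p := 1 + b) (i := 1) le_rfl le_rfl rfl
    (E.pow ω 1) (E.pow ω b)
  rw [← e4] at e3
  have e5 : ∀ j (hj : j = 1 + a) (h1 : 1 ≤ j) (h2 : j ≤ a + 1 + b) (z : (E.obj (a + 1 + b)).obj A),
      (E.d (a + 1 + b) j h1 h2).app A z = (E.d (a + 1 + b) (1 + a) (by omega) (by omega)).app A z := by
    intro j hj _ _ z
    subst hj
    rfl
  rw [e5 (a + 1) (by omega), ← e3]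
  rw [e1, ← e2, E.pow_add, E.pow_add]

theorem s_pow (E : SDC.{u, w} Λ) {A : ArtAlg Λ} {ω : (E.obj 1).obj A} (hω : E.IsMC ω) {n i : ℕ} (h : i < n + 1) :
    (E.s n i h).app A (E.pow ω (n + 1)) = E.pow ω n := by
  obtain ⟨b, rfl⟩ := Nat.exists_eq_add_of_le (Nat.le_of_lt_succ h)
  have e1 : E.pow ω 1 = ω := E.isSDC.one_mul _ _
  rw [← E.pow_add ω (show i + (b + 1) = i + b + 1 by omega),
    ← E.pow_add ω (show 0 + 1 + b = b + 1 by omega)]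
  have e3 := E.isSDC.mul_s (m := i) (n := b) (p := i + b) (i := 0) (by omega) rfl
    (E.pow ω i) (E.mul (show 0 + 1 + b = b + 1 by omega) (E.pow ω 1) (E.pow ω b))
  have e4 := E.isSDC.s_mul (m := 0) (n := b) (p := b) (i := 0) (by omega) (by omega)
    (E.pow ω 1) (E.pow ω b)
  rw [← e4] at e3
  have e5 : ∀ j (hj : j = 0 + i) (h1 : j < i + b + 1) (z : (E.obj (i + b + 1)).obj A),
      (E.s (i + b) j h1).app A z = (E.s (i + b) (0 + i) (by omega)).app A z := by
    intro j hj _ z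
    subst hj
    rfl
  refine (e5 i (by omega) _ _).trans (e3.symm.trans ?_)
  rw [e1, s_mc E hω, E.isSDC.one_mul, E.pow_add]

end SDC

section Fibre

variable {Λ : Type u} [CommRing Λ] [IsLocalRing Λ] [IsNoetherianRing Λ]

/-- The fibre `E_{φ,x}`: `E^n_{φ,x}(A)` is the fibre of `φ : E^n(A) → F^n(A)` over `x^n`, with
the operations of `E`. -/
noncomputable def fibre {E F : SDC.{u, w} Λ} (φ : E.Hom F.toPreSDC) (x : ProLimit F.mc) :
    PreSDC.{u, w} Λ where
  obj n :=
    { obj A := {e : (E.obj n).obj A // (φ.app n).app A e = F.pow (PreSDC.mcAt x A) n}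
      map {A B} f := TypeCat.ofHom fun e => ⟨(E.obj n).map f e.1, by
        rw [NatTrans.naturality_apply, e.2, F.map_pow, PreSDC.map_mcAt]⟩
      map_id A := ConcreteCategory.hom_ext _ _ fun e =>
        Subtype.ext (Functor.map_id_apply (E.obj n) A e.1)
      map_comp f g := ConcreteCategory.hom_ext _ _ fun e =>
        Subtype.ext (Functor.map_comp_apply (E.obj n) f g e.1) }
  d n i h1 h2 :=
    { app A := TypeCat.ofHom fun e => ⟨(E.d n i h1 h2).app A e.1, by
        rw [φ.map_d, e.2, F.d_pow (PreSDC.isMC_mcAt x A)]⟩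
      naturality A B f := ConcreteCategory.hom_ext _ _ fun e =>
        Subtype.ext (NatTrans.naturality_apply (E.d n i h1 h2) f e.1) }
  s n i h :=
    { app A := TypeCat.ofHom fun e => ⟨(E.s n i h).app A e.1, by
        rw [φ.map_s, e.2, F.s_pow (PreSDC.isMC_mcAt x A)]⟩
      naturality A B f := ConcreteCategory.hom_ext _ _ fun e =>
        Subtype.ext (NatTrans.naturality_apply (E.s n i h) f e.1) }
  mul h A e f := ⟨E.mul h e.1 f.1, by rw [φ.map_mul, e.2, f.2, F.pow_add]⟩
  one A := ⟨E.one A, φ.map_one A⟩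
  map_mul h A B g e f := Subtype.ext (E.map_mul h g e.1 f.1)
  map_one g := Subtype.ext (E.map_one g)

/-- The inclusion `E_{φ,x} → E`. -/
noncomputable def fibreIncl {E F : SDC.{u, w} Λ} (φ : E.Hom F.toPreSDC) (x : ProLimit F.mc) :
    (fibre φ x).Hom E.toPreSDC where
  app _ :=
    { app _ := TypeCat.ofHom fun e => e.1
      naturality _ _ _ := rfl }
  map_d _ _ _ _ := rfl
  map_s _ _ _ := rfl
  map_mul _ _ _ _ := rfl
  map_one _ := rfl

/-- Objects of the deformation groupoid `Def_E(A)`: elements of `MC_E(A)`. -/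
structure DefObj (E : SDC.{u, w} Λ) (A : ArtAlg Λ) : Type w where
  point : (E.obj 1).obj A
  isMC : E.IsMC point

/-- `Def_E(A)`: a morphism `ω → ω'` is an element `g ∈ E^0(A)` with `g * ω * g⁻¹ = ω'`. -/
noncomputable instance (E : SDC.{u, w} Λ) (A : ArtAlg Λ) : Groupoid.{w} (DefObj E A) where
  Hom ω ω' := {g : (E.obj 0).obj A // E.conj g ω.point = ω'.point}
  id ω := ⟨1, E.conj_one _⟩
  comp g h := ⟨h.1 * g.1, by rw [← E.conj_conj, g.2, h.2]⟩
  id_comp g := Subtype.ext (mul_one g.1)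
  comp_id g := Subtype.ext (one_mul g.1)
  assoc g h k := Subtype.ext (mul_assoc k.1 h.1 g.1).symm
  inv g := ⟨g.1⁻¹, E.conj_inv g.2⟩
  inv_comp g := Subtype.ext (mul_inv_cancel g.1)
  comp_inv g := Subtype.ext (inv_mul_cancel g.1)

/-- Objects of `Def_{φ,x}(A)`: pairs `(ω, h) ∈ MC_E(A) × F^0(A)` with `h φ(ω) h⁻¹ = x`. -/
structure DefFibreObj {E F : SDC.{u, w} Λ} (φ : E.Hom F.toPreSDC) (x : ProLimit F.mc)
    (A : ArtAlg Λ) : Type w where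
  point : (E.obj 1).obj A
  isMC : E.IsMC point
  path : (F.obj 0).obj A
  conj_path : F.conj path ((φ.app 1).app A point) = PreSDC.mcAt x A

/-- `Def_{φ,x}(A)`: a morphism `(ω, h) → (ω', h')` is an element `g ∈ E^0(A)` with
`(ω', h') = (g ω g⁻¹, h φ(g)⁻¹)`. -/
noncomputable instance {E F : SDC.{u, w} Λ} (φ : E.Hom F.toPreSDC) (x : ProLimit F.mc)
    (A : ArtAlg Λ) : Groupoid.{w} (DefFibreObj φ x A) where
  Hom X Y := {g : (E.obj 0).obj A //
    E.conj g X.point = Y.point ∧ X.path * (SDC.homGauge φ A g)⁻¹ = Y.path}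
  id X := ⟨1, E.conj_one _, by rw [map_one, inv_one, mul_one]⟩
  comp g h := ⟨h.1 * g.1, by rw [← E.conj_conj, g.2.1, h.2.1],
    by rw [map_mul, mul_inv_rev, ← mul_assoc, g.2.2, h.2.2]⟩
  id_comp g := Subtype.ext (mul_one g.1)
  comp_id g := Subtype.ext (one_mul g.1)
  assoc g h k := Subtype.ext (mul_assoc k.1 h.1 g.1).symm
  inv g := ⟨g.1⁻¹, E.conj_inv g.2.1,
    by
    rw [map_inv, inv_inv]
    exact (mul_inv_eq_iff_eq_mul.1 g.2.2).symm⟩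
  inv_comp g := Subtype.ext (mul_inv_cancel g.1)
  comp_inv g := Subtype.ext (inv_mul_cancel g.1)

theorem DefObj.ext {E : SDC.{u, w} Λ} {A : ArtAlg Λ} {X Y : DefObj E A}
    (h : X.point = Y.point) : X = Y := by
  obtain ⟨X, hX⟩ := X
  obtain ⟨Y, hY⟩ := Y
  obtain rfl : X = Y := h
  rfl

theorem DefObj.functor_ext {E : SDC.{u, w} Λ} {A : ArtAlg Λ} {C : Type w} [Category.{w} C]
    {S T : C ⥤ DefObj E A} (h1 : ∀ X, (S.obj X).point = (T.obj X).point)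
    (h2 : ∀ {X Y} (f : X ⟶ Y), (S.map f).1 = (T.map f).1) : S = T := by
  have comp_val : ∀ {X Y Z W : DefObj E A} (a : X ⟶ Y) (b : Y ⟶ Z) (c : Z ⟶ W),
      (a ≫ b ≫ c).1 = (c.1 * b.1) * a.1 := fun _ _ _ => rfl
  have key : ∀ {X Y : DefObj E A} (h : X = Y), (eqToHom h).1 = 1 := by
    intro X Y h
    subst h
    rfl
  refine CategoryTheory.Functor.ext (fun X => DefObj.ext (h1 X)) fun X Y f => Subtype.ext ?_
  exact (h2 f).trans ((comp_val _ _ _).trans (by rw [key, key, one_mul, mul_one])).symm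

theorem DefFibreObj.ext {E F : SDC.{u, w} Λ} {φ : E.Hom F.toPreSDC} {x : ProLimit F.mc}
    {A : ArtAlg Λ} {X Y : DefFibreObj φ x A} (h : X.point = Y.point)
    (h' : X.path = Y.path) : X = Y := by
  obtain ⟨X, hX, p, hp⟩ := X
  obtain ⟨Y, hY, q, hq⟩ := Y
  obtain rfl : X = Y := h
  obtain rfl : p = q := h'
  rfl

theorem DefFibreObj.functor_ext {E F : SDC.{u, w} Λ} {φ : E.Hom F.toPreSDC}
    {x : ProLimit F.mc} {A : ArtAlg Λ} {C : Type w} [Category.{w} C]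
    {S T : C ⥤ DefFibreObj φ x A} (h1 : ∀ X, (S.obj X).point = (T.obj X).point)
    (h1' : ∀ X, (S.obj X).path = (T.obj X).path)
    (h2 : ∀ {X Y} (f : X ⟶ Y), (S.map f).1 = (T.map f).1) : S = T := by
  have comp_val : ∀ {X Y Z W : DefFibreObj φ x A} (a : X ⟶ Y) (b : Y ⟶ Z) (c : Z ⟶ W),
      (a ≫ b ≫ c).1 = (c.1 * b.1) * a.1 := fun _ _ _ => rfl
  have key : ∀ {X Y : DefFibreObj φ x A} (h : X = Y), (eqToHom h).1 = 1 := by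
    intro X Y h
    subst h
    rfl
  refine CategoryTheory.Functor.ext (fun X => DefFibreObj.ext (h1 X) (h1' X)) fun X Y f => Subtype.ext ?_
  exact (h2 f).trans ((comp_val _ _ _).trans (by rw [key, key, one_mul, mul_one])).symm

/-- The deformation groupoid `Def_E`, as a functor from `C_Λ` to groupoids. -/
noncomputable def SDC.defGrpd (E : SDC.{u, w} Λ) : ArtAlg Λ ⥤ Grpd.{w, w} where
  obj A := Grpd.of (DefObj E A)
  map {A B} f :=
    { obj := fun (X : DefObj E A) => (⟨(E.obj 1).map f X.point, X.isMC.map f⟩ : DefObj E B)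
      map := fun {X Y} (g : X ⟶ Y) => ⟨(E.obj 0).map f g.1, by
        refine (E.map_conj f g.1 X.point).symm.trans ?_
        rw [g.2]⟩
      map_id := fun X => Subtype.ext (E.map_one f)
      map_comp := fun {X Y Z} g h => Subtype.ext (E.map_mul rfl f h.1 g.1) }
  map_id A := DefObj.functor_ext
    (fun (X : DefObj E A) => Functor.map_id_apply (E.obj 1) A X.point)
    (fun g => Functor.map_id_apply (E.obj 0) A g.1)
  map_comp f g := DefObj.functor_ext
    (fun (X : DefObj E _) => Functor.map_comp_apply (E.obj 1) f g X.point)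
    (fun h => Functor.map_comp_apply (E.obj 0) f g h.1)

/-- The groupoid `Def_{φ,x}` (the homotopy fibre of `Def_E → Def_F` over `x`), as a functor from
`C_Λ` to groupoids. -/
noncomputable def defFibre {E F : SDC.{u, w} Λ} (φ : E.Hom F.toPreSDC) (x : ProLimit F.mc) :
    ArtAlg Λ ⥤ Grpd.{w, w} where
  obj A := Grpd.of (DefFibreObj φ x A)
  map {A B} f :=
    { obj := fun (X : DefFibreObj φ x A) => (⟨(E.obj 1).map f X.point, X.isMC.map f, F.mapGauge f X.path, by
        rw [← PreSDC.map_mcAt x f, ← X.conj_path, F.map_conj]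
        congr 1
        exact NatTrans.naturality_apply (φ.app 1) f X.point⟩ : DefFibreObj φ x B)
      map := fun {X Y} (g : X ⟶ Y) => ⟨E.mapGauge f g.1, by
        refine (E.map_conj f g.1 X.point).symm.trans ?_
        rw [g.2.1], by
        have h1 : SDC.homGauge φ B (E.mapGauge f g.1) = F.mapGauge f (SDC.homGauge φ A g.1) :=
          NatTrans.naturality_apply (φ.app 0) f g.1
        rw [h1, ← map_inv, ← map_mul, g.2.2]⟩
      map_id := fun X => Subtype.ext (E.map_one f)
      map_comp := fun {X Y Z} g h => Subtype.ext (E.map_mul rfl f h.1 g.1) }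
  map_id A := DefFibreObj.functor_ext
    (fun (X : DefFibreObj φ x A) => Functor.map_id_apply (E.obj 1) A X.point)
    (fun (X : DefFibreObj φ x A) => Functor.map_id_apply (F.obj 0) A X.path)
    (fun g => Functor.map_id_apply (E.obj 0) A g.1)
  map_comp f g := DefFibreObj.functor_ext
    (fun (X : DefFibreObj φ x _) => Functor.map_comp_apply (E.obj 1) f g X.point)
    (fun (X : DefFibreObj φ x _) => Functor.map_comp_apply (F.obj 0) f g X.path)
    (fun h => Functor.map_comp_apply (E.obj 0) f g h.1)

/-- The fibre `E_{φ,x}`, bundled as an SDC. -/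
noncomputable def fibreSDC {E F : SDC.{u, w} Λ} (φ : E.Hom F.toPreSDC) (x : ProLimit F.mc)
    (h : IsSDC (fibre φ x)) : SDC.{u, w} Λ :=
  { fibre φ x with isSDC := h }

/-- The canonical map `Def_{E_{φ,x}} → Def_{φ,x}`: it sends `ω` to `(ω, 1)` and `g` to `g`. -/
noncomputable def comparison {E F : SDC.{u, w} Λ} (φ : E.Hom F.toPreSDC) (x : ProLimit F.mc)
    (h : IsSDC (fibre φ x)) : (fibreSDC φ x h).defGrpd ⟶ defFibre φ x where
  app A :=
    { obj := fun (X : DefObj (fibreSDC φ x h) A) =>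
        (⟨X.point.1, congrArg Subtype.val X.isMC, 1, by
          rw [F.conj_one, X.point.2]
          exact F.isSDC.one_mul _ _⟩ : DefFibreObj φ x A)
      map := fun {X Y} (g : X ⟶ Y) => ⟨g.1.1, by
        have h1 := SDC.hom_conj (E := fibreSDC φ x h) (F := E) (fibreIncl φ x) g.1 X.point
        rw [g.2] at h1
        exact h1.symm, by
        have h1 : SDC.homGauge φ A g.1.1 = 1 := g.1.2
        rw [h1, inv_one, mul_one]⟩
      map_id := fun X => rfl
      map_comp := fun f g => rfl }
  naturality A B f := DefFibreObj.functor_ext (fun X => rfl)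
    (fun X => (F.map_one f).symm) (fun g => rfl)

end Fibre

/-!
The one non-formal point is that each `φ : E^n → F^n` is smooth as a transformation of functors:
for every surjection `B → A`, the map `E^n(B) → E^n(A) ×_{F^n(A)} F^n(B)` is onto
(`LiftsAlong.of_surjective`). This holds for any transformation `G → H` of smooth homogeneous
pointed functors that is onto on tangent spaces. A surjection factors into small ones, with kernel
generated by a `t ≠ 0` killed by the maximal ideal. For such a surjection,
`(b, r + s ε) ↦ (b, b + s t)` identifies `B ×_k k[ε]` with `B ×_A B` (`ArtAlg.exists_difference`), so by homogeneity two
elements of `H(B)` with the same image in `H(A)` differ by a tangent vector of `H`. To lift a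
compatible pair, lift its first component by smoothness of `G`, and correct this lift by a
preimage in the tangent space of `G` of the resulting error (`LiftsAlong.of_small`).

Consequently the fibre of `φ` over the elements `x^n` is smooth. It is homogeneous because `E^n`
and `F^n` are, and it inherits all identities from `E` (`PreSDC.Hom.isSDC_fibre`).

Relative smoothness over `A → k` also shows that `E^0(A) → F^0(A)` is onto. An object `(ω, h)` of
`Def_{φ,x}(A)` is therefore isomorphic to `(g ω g⁻¹, 1)` for any `g` with `φ(g) = h`, and the
latter comes from the fibre; morphisms between objects `(ω, 1)` are the `g` with `φ(g) = 1`, which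
are the gauges of the fibre (`comparison_isEquivalence`).
-/

/-! ### Socle elements of Artinian algebras -/

/-- If `J ⊄ K` are ideals of an Artinian local ring, then `(J + K)/K` contains a nonzero element
killed by the maximal ideal. -/
theorem IsLocalRing.exists_mem_socle_quotient {R : Type*} [CommRing R] [IsLocalRing R]
    [IsArtinianRing R] {J K : Ideal R} (hJK : ¬ J ≤ K) :
    ∃ t ∈ J, t ∉ K ∧ ∀ a ∈ IsLocalRing.maximalIdeal R, a * t ∈ K := by
  obtain ⟨n, hn⟩ := (isArtinianRing_iff_isNilpotent_maximalIdeal R).1 inferInstance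
  have hnK : IsLocalRing.maximalIdeal R ^ n * J ≤ K := by
    rw [hn, zero_mul]
    exact bot_le
  clear hn
  induction n with
  | zero => rw [pow_zero, one_mul] at hnK; exact absurd hnK hJK
  | succ n ih =>
    by_cases h : IsLocalRing.maximalIdeal R ^ n * J ≤ K
    · exact ih h
    obtain ⟨t, ht, htK⟩ := SetLike.not_le_iff_exists.1 h
    have hJ : IsLocalRing.maximalIdeal R ^ n * J ≤ J := Ideal.mul_le_right
    refine ⟨t, hJ ht, htK, fun a ha => hnK ?_⟩
    rw [pow_succ', mul_assoc]
    exact Ideal.mul_mem_mul ha ht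

namespace ArtAlg

variable {Λ : Type u} [CommRing Λ] [IsLocalRing Λ]

theorem algebraMap_residueField_surjective :
    Function.Surjective (algebraMap Λ (IsLocalRing.ResidueField Λ)) :=
  IsLocalRing.residue_surjective

/-- The reduction `A → k` of an object of `C_Λ` to its residue field, identified with the residue
field of `Λ`. -/
noncomputable def toResidueField (A : ArtAlg Λ) : A ⟶ residueField Λ :=
  let j : IsLocalRing.ResidueField Λ →ₐ[Λ] (A ⧸ IsLocalRing.maximalIdeal A) :=
    Ideal.Quotient.liftₐ (IsLocalRing.maximalIdeal Λ)
      (Algebra.ofId Λ (A ⧸ IsLocalRing.maximalIdeal A)) fun _ hl =>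
        Ideal.Quotient.eq_zero_iff_mem.2 (algebraMap_mem hl)
  have hj : Function.Bijective j :=
    ⟨RingHom.injective (R := IsLocalRing.ResidueField Λ) j.toRingHom, fun a => by
      obtain ⟨l, rfl⟩ := A.residue_surjective a
      exact ⟨IsLocalRing.residue Λ l, rfl⟩⟩
  (AlgEquiv.ofBijective j hj).symm.toAlgHom.comp
    (Ideal.Quotient.mkₐ Λ (IsLocalRing.maximalIdeal A))

theorem hom_residueField_surjective {A : ArtAlg Λ} (f : A ⟶ residueField Λ) :
    Function.Surjective (hom f) := fun b => by
  obtain ⟨l, rfl⟩ := algebraMap_residueField_surjective b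
  exact ⟨algebraMap Λ A l, (hom f).commutes l⟩

theorem hom_residueField_eq {A : ArtAlg Λ} (f : A ⟶ residueField Λ) {a : A} {l : Λ}
    (h : a - algebraMap Λ A l ∈ IsLocalRing.maximalIdeal A) :
    hom f a = algebraMap Λ (residueField Λ) l := by
  have h1 : IsNilpotent (hom f (a - algebraMap Λ A l)) := (isNilpotent_of_mem h).map (hom f)
  rw [map_sub, AlgHom.commutes] at h1
  exact sub_eq_zero.1 (IsNilpotent.eq_zero (R := IsLocalRing.ResidueField Λ) h1)

theorem mem_maximalIdeal_of_map_eq_zero {A B : ArtAlg Λ} (f : B ⟶ A) {b : B}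
    (h : hom f b = 0) : b ∈ IsLocalRing.maximalIdeal B := fun hu => by
  have h1 := hu.map (hom f)
  rw [h] at h1
  exact not_isUnit_zero h1

variable (Λ) in
/-- The augmentation `k[ε] → k`, `ε ↦ 0`. -/
noncomputable def dualNumbersFst : dualNumbers Λ ⟶ residueField Λ :=
  TrivSqZeroExt.fstHom Λ (IsLocalRing.ResidueField Λ) (IsLocalRing.ResidueField Λ)

/-- For `t ∈ B` killed by the maximal ideal, the `Λ`-linear map `k → B`, `s ↦ s t`. -/
noncomputable def socleMap {B : ArtAlg Λ} (t : B)
    (ht : ∀ m ∈ IsLocalRing.maximalIdeal B, m * t = 0) :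
    IsLocalRing.ResidueField Λ →ₗ[Λ] B :=
  Submodule.liftQ (IsLocalRing.maximalIdeal Λ) (LinearMap.toSpanSingleton Λ B t) fun l hl => by
    rw [LinearMap.mem_ker, LinearMap.toSpanSingleton_apply, Algebra.smul_def]
    exact ht _ (algebraMap_mem hl)

section socleMap

variable {B : ArtAlg Λ} {t : B} (ht : ∀ m ∈ IsLocalRing.maximalIdeal B, m * t = 0)

theorem socleMap_algebraMap (l : Λ) :
    socleMap t ht (algebraMap Λ (IsLocalRing.ResidueField Λ) l) = algebraMap Λ B l * t :=
  (Algebra.smul_def l t)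

/-- The map `s ↦ s t` in terms of representatives of `s` in `B` rather than in `Λ`; the choice of
the map `f : B → k` is immaterial. -/
theorem socleMap_residue (f : B ⟶ residueField Λ) (b : B) : socleMap t ht (hom f b) = b * t := by
  obtain ⟨l, hl⟩ := B.exists_sub_mem b
  rw [hom_residueField_eq f hl]
  refine (socleMap_algebraMap ht l).trans ?_
  have h := ht _ hl
  rw [sub_mul, sub_eq_zero] at h
  exact h.symm

theorem mul_socleMap (f : B ⟶ residueField Λ) {b : B} {r : IsLocalRing.ResidueField Λ}
    (hr : hom f b = r) (s : IsLocalRing.ResidueField Λ) :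
    b * socleMap t ht s = socleMap t ht (r * s) := by
  obtain ⟨c, hc⟩ := hom_residueField_surjective f s
  have h : hom f (b * c) = r * s := by
    rw [map_mul]
    exact congrArg₂ (fun a a' : IsLocalRing.ResidueField Λ => a * a') hr hc
  have h1 := socleMap_residue ht f (b * c)
  have h2 := socleMap_residue ht f c
  rw [h] at h1
  rw [hc] at h2
  rw [h1, h2, mul_assoc]

theorem socleMap_mul_socleMap (htm : t ∈ IsLocalRing.maximalIdeal B)
    (s s' : IsLocalRing.ResidueField Λ) : socleMap t ht s * socleMap t ht s' = 0 := by
  obtain ⟨l, rfl⟩ := algebraMap_residueField_surjective s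
  obtain ⟨l', rfl⟩ := algebraMap_residueField_surjective s'
  rw [socleMap_algebraMap, socleMap_algebraMap]
  linear_combination algebraMap Λ B l * algebraMap Λ B l' * ht t htm

theorem socleMap_injective (ht0 : t ≠ 0) : Function.Injective (socleMap t ht) := by
  rw [injective_iff_map_eq_zero]
  intro s hs
  obtain ⟨l, rfl⟩ := algebraMap_residueField_surjective s
  rw [socleMap_algebraMap] at hs
  by_contra h
  have hu : IsUnit l := by
    by_contra hl
    exact h (Ideal.Quotient.eq_zero_iff_mem.2 hl)
  exact ht0 ((hu.map (algebraMap Λ B)).mul_right_eq_zero.1 hs)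

theorem map_socleMap {A : ArtAlg Λ} (f : B ⟶ A) (hft : hom f t = 0)
    (s : IsLocalRing.ResidueField Λ) : hom f (socleMap t ht s) = 0 := by
  obtain ⟨l, rfl⟩ := algebraMap_residueField_surjective s
  rw [socleMap_algebraMap, map_mul, hft, mul_zero]

end socleMap

/-! ### Small extensions and dual numbers -/

variable [IsNoetherianRing Λ]

/-- For `t` in the maximal ideal of `B` and killed by it, the morphism
`B ×_k k[ε] → B`, `(b, r + s ε) ↦ b + s t`. -/
noncomputable def translate {B : ArtAlg Λ} (t : B)
    (ht : ∀ m ∈ IsLocalRing.maximalIdeal B, m * t = 0) (htm : t ∈ IsLocalRing.maximalIdeal B) :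
    pullback B.toResidueField (dualNumbersFst Λ) ⟶ B :=
  let q : pullback B.toResidueField (dualNumbersFst Λ) → B :=
    fun p => p.1.1 + socleMap t ht (TrivSqZeroExt.snd p.1.2)
  { toFun := q
    map_one' := by
      change (1 : B) + socleMap t ht 0 = 1
      rw [map_zero, add_zero]
    map_zero' := by
      change (0 : B) + socleMap t ht 0 = 0
      rw [map_zero, add_zero]
    map_add' := fun p p' => by
      change (p.1.1 + p'.1.1 : B) +
          socleMap t ht (TrivSqZeroExt.snd p.1.2 + TrivSqZeroExt.snd p'.1.2) =
        (p.1.1 + socleMap t ht (TrivSqZeroExt.snd p.1.2)) +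
          (p'.1.1 + socleMap t ht (TrivSqZeroExt.snd p'.1.2))
      rw [map_add]
      ring
    map_mul' := fun p p' => by
      have e : hom B.toResidueField p.1.1 = TrivSqZeroExt.fst p.1.2 := p.2
      have e' : hom B.toResidueField p'.1.1 = TrivSqZeroExt.fst p'.1.2 := p'.2
      change (p.1.1 * p'.1.1 : B) +
          socleMap t ht (TrivSqZeroExt.fst p.1.2 * TrivSqZeroExt.snd p'.1.2 +
            TrivSqZeroExt.snd p.1.2 * TrivSqZeroExt.fst p'.1.2) =
        (p.1.1 + socleMap t ht (TrivSqZeroExt.snd p.1.2)) *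
          (p'.1.1 + socleMap t ht (TrivSqZeroExt.snd p'.1.2))
      have h1 := mul_socleMap ht B.toResidueField e (TrivSqZeroExt.snd p'.1.2)
      have h2 := mul_socleMap ht B.toResidueField e' (TrivSqZeroExt.snd p.1.2)
      have h3 := socleMap_mul_socleMap ht htm (TrivSqZeroExt.snd p.1.2) (TrivSqZeroExt.snd p'.1.2)
      rw [map_add, mul_comm (TrivSqZeroExt.snd p.1.2)]
      linear_combination - h1 - h2 - h3
    commutes' := fun r => by
      change algebraMap Λ B r + socleMap t ht 0 = algebraMap Λ B r
      rw [map_zero, add_zero] }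

theorem translate_comp {A B : ArtAlg Λ} (f : B ⟶ A) {t : B}
    (ht : ∀ m ∈ IsLocalRing.maximalIdeal B, m * t = 0) (htm : t ∈ IsLocalRing.maximalIdeal B)
    (hft : hom f t = 0) : translate t ht htm ≫ f = fst _ _ ≫ f :=
  AlgHom.ext fun p => (map_add (hom f) _ _).trans <| by
    rw [map_socleMap ht f hft]
    exact add_zero _

/-- For a surjection `f : B → A` whose kernel is generated by `t ≠ 0` and killed by the maximal
ideal, `B ×_A B` is isomorphic to `B ×_k k[ε]`: two elements of `B` with the same image in `A`
differ by a unique multiple `s t` with `s ∈ k`. Only the resulting map `B ×_A B → B ×_k k[ε]`,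
and its compatibility with the projections, is recorded. -/
theorem exists_difference {A B : ArtAlg Λ} (f : B ⟶ A) {t : B}
    (hker : RingHom.ker (hom f) = Ideal.span {t}) (ht0 : t ≠ 0)
    (ht : ∀ m ∈ IsLocalRing.maximalIdeal B, m * t = 0) (htm : t ∈ IsLocalRing.maximalIdeal B) :
    ∃ β : pullback f f ⟶ pullback B.toResidueField (dualNumbersFst Λ),
      β ≫ fst _ _ = fst f f ∧ β ≫ translate t ht htm = snd f f := by
  have hft : hom f t = 0 := by
    have : t ∈ RingHom.ker (hom f) := hker ▸ Ideal.mem_span_singleton_self t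
    exact this
  let α : pullback B.toResidueField (dualNumbersFst Λ) ⟶ pullback f f :=
    lift (fst _ _) (translate t ht htm) (translate_comp f ht htm hft).symm
  have hα : Function.Bijective (hom α) := by
    constructor
    · intro p p' h
      have h1 : p.1.1 = p'.1.1 := congrArg (fun r => r.1.1) h
      have h2 : p.1.1 + socleMap t ht (TrivSqZeroExt.snd p.1.2) =
        p'.1.1 + socleMap t ht (TrivSqZeroExt.snd p'.1.2) := congrArg (fun r => r.1.2) h
      rw [h1] at h2
      have h3 := socleMap_injective ht ht0 (add_left_cancel h2)
      have e : hom B.toResidueField p.1.1 = TrivSqZeroExt.fst p.1.2 := p.2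
      have e' : hom B.toResidueField p'.1.1 = TrivSqZeroExt.fst p'.1.2 := p'.2
      rw [h1] at e
      exact Subtype.ext (Prod.ext h1 (TrivSqZeroExt.ext (e.symm.trans e') h3))
    · intro r
      have h1 : r.1.2 - r.1.1 ∈ RingHom.ker (hom f) := by
        rw [RingHom.mem_ker, map_sub, sub_eq_zero]
        exact r.2.symm
      rw [hker, Ideal.mem_span_singleton'] at h1
      obtain ⟨c, hc⟩ := h1
      let v : DualNumber (IsLocalRing.ResidueField Λ) :=
        (hom B.toResidueField r.1.1, hom B.toResidueField c)
      refine ⟨⟨(r.1.1, v), rfl⟩, Subtype.ext (Prod.ext rfl ?_)⟩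
      change r.1.1 + socleMap t ht (hom B.toResidueField c) = r.1.2
      rw [socleMap_residue, hc, add_sub_cancel]
  let e := AlgEquiv.ofBijective (hom α) hα
  have he : ∀ r, hom α (e.symm r) = r := e.apply_symm_apply
  exact ⟨e.symm.toAlgHom, AlgHom.ext fun r => congrArg (fun r => r.1.1) (he r),
    AlgHom.ext fun r => congrArg (fun r => r.1.2) (he r)⟩

end ArtAlg

/-! ### Lifting along surjections -/

section Lifting

variable {Λ : Type u} [CommRing Λ] [IsLocalRing Λ]

theorem IsPointed.subsingleton {G : ArtAlg Λ ⥤ Type w} (h : IsPointed G) :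
    Subsingleton (G.obj (ArtAlg.residueField Λ)) := by
  obtain ⟨_⟩ := h
  infer_instance

/-- The lifting property of `φ : G → H` against `f : B → A`: the map
`G(B) → G(A) ×_{H(A)} H(B)` is onto. -/
def LiftsAlong {G H : ArtAlg Λ ⥤ Type w} (φ : G ⟶ H) {B A : ArtAlg Λ} (f : B ⟶ A) : Prop :=
  ∀ (a : G.obj A) (h : H.obj B), φ.app A a = H.map f h →
    ∃ g : G.obj B, G.map f g = a ∧ φ.app B g = h

theorem LiftsAlong.comp {G H : ArtAlg Λ ⥤ Type w} {φ : G ⟶ H} {C B A : ArtAlg Λ} {f : C ⟶ B}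
    {g : B ⟶ A} (hf : LiftsAlong φ f) (hg : LiftsAlong φ g) : LiftsAlong φ (f ≫ g) := by
  intro a h hah
  rw [Functor.map_comp_apply] at hah
  obtain ⟨b, rfl, hb⟩ := hg a _ hah
  obtain ⟨c, rfl, hc⟩ := hf b h hb
  exact ⟨c, Functor.map_comp_apply _ _ _ _, hc⟩

theorem LiftsAlong.of_bijective {G H : ArtAlg Λ ⥤ Type w} (φ : G ⟶ H) {B A : ArtAlg Λ}
    (f : B ⟶ A) (hf : Function.Bijective (ArtAlg.hom f)) : LiftsAlong φ f := by
  intro a h hah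
  let e := AlgEquiv.ofBijective (ArtAlg.hom f) hf
  let g : A ⟶ B := e.symm.toAlgHom
  have hgf : g ≫ f = 𝟙 A := AlgHom.ext fun a => e.apply_symm_apply a
  have hfg : f ≫ g = 𝟙 B := AlgHom.ext fun a => e.symm_apply_apply a
  refine ⟨G.map g a, ?_, ?_⟩
  · rw [← Functor.map_comp_apply, hgf, Functor.map_id_apply]
  · rw [NatTrans.naturality_apply, hah, ← Functor.map_comp_apply, hfg, Functor.map_id_apply]

variable [IsNoetherianRing Λ]

/-- Lifting along a small extension. Smoothness of `G` gives some lift `g` of `a`. The difference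
of `φ(g)` and the prescribed `h` is a tangent vector of `H`, which lifts to a tangent vector
of `G`; translating `g` by the latter corrects it. -/
theorem LiftsAlong.of_small {G H : ArtAlg Λ ⥤ Type w} {φ : G ⟶ H} (hGs : IsSmooth G)
    (hGh : IsHomogeneous G) (hHh : IsHomogeneous H)
    (hG0 : Subsingleton (G.obj (ArtAlg.residueField Λ)))
    (hφ : Function.Surjective (φ.app (ArtAlg.dualNumbers Λ)))
    {A B : ArtAlg Λ} (f : B ⟶ A) (hf : Function.Surjective (ArtAlg.hom f)) {t : B}
    (hker : RingHom.ker (ArtAlg.hom f) = Ideal.span {t}) (ht0 : t ≠ 0)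
    (ht : ∀ m ∈ IsLocalRing.maximalIdeal B, m * t = 0) : LiftsAlong φ f := by
  intro a h hah
  have hft : ArtAlg.hom f t = 0 :=
    (show t ∈ RingHom.ker (ArtAlg.hom f) from hker ▸ Ideal.mem_span_singleton_self t)
  have htm := ArtAlg.mem_maximalIdeal_of_map_eq_zero f hft
  obtain ⟨β, hβ1, hβ2⟩ := ArtAlg.exists_difference f hker ht0 ht htm
  have hπ := ArtAlg.hom_residueField_surjective B.toResidueField
  obtain ⟨g, rfl⟩ := hGs f hf a
  rw [NatTrans.naturality_apply] at hah
  -- `p = (φ(g), h)` in `H(B ×_A B)`; the component of `β(p)` in `H(k[ε])` is the error of `g`.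
  obtain ⟨p, hp1, hp2⟩ := hHh.exists_glue (f := f) (g := f) hf _ h hah
  obtain ⟨w, hw⟩ := hφ (H.map (ArtAlg.snd _ _) (H.map β p))
  obtain ⟨r, hr1, hr2⟩ := hGh.exists_glue (f := B.toResidueField) (g := ArtAlg.dualNumbersFst Λ)
    hπ g w (Subsingleton.elim _ _)
  -- Both sides have components `φ(g)` and `φ(w)`.
  have hr : φ.app _ r = H.map β p := by
    refine hHh.ext hπ ?_ ?_
    · rw [← NatTrans.naturality_apply, hr1, ← Functor.map_comp_apply, hβ1, hp1]
    · rw [← NatTrans.naturality_apply, hr2, hw]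
  refine ⟨G.map (ArtAlg.translate t ht htm) r, ?_, ?_⟩
  · have hα := ArtAlg.translate_comp f ht htm hft
    rw [← Functor.map_comp_apply, hα, Functor.map_comp_apply, hr1]
  · rw [NatTrans.naturality_apply, hr, ← Functor.map_comp_apply, hβ2, hp2]

/-- A transformation of smooth homogeneous pointed functors that is onto on tangent spaces is
smooth: it lifts along every surjection, as surjections factor into small extensions. -/
theorem LiftsAlong.of_surjective {G H : ArtAlg Λ ⥤ Type w} {φ : G ⟶ H} (hGs : IsSmooth G)
    (hGh : IsHomogeneous G) (hHh : IsHomogeneous H)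
    (hG0 : Subsingleton (G.obj (ArtAlg.residueField Λ)))
    (hφ : Function.Surjective (φ.app (ArtAlg.dualNumbers Λ)))
    {A B : ArtAlg Λ} (f : B ⟶ A) (hf : Function.Surjective (ArtAlg.hom f)) :
    LiftsAlong φ f := by
  let J : Ideal B := RingHom.ker (ArtAlg.hom f)
  have hJ : J ≠ ⊤ := RingHom.ker_ne_top _
  -- Descending induction on the ideal `K ≤ J`, for the factorisation `B → B/K → A` of `f`.
  have key : ∀ (K : Ideal B) (hK : K ≤ J),
      LiftsAlong φ (B := B.quot K (ne_top_of_le_ne_top hJ hK))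
        (Ideal.Quotient.liftₐ K (ArtAlg.hom f) hK) := by
    intro K
    induction K using WellFoundedGT.induction with
    | _ K ih =>
      intro hK
      have hK1 := ne_top_of_le_ne_top hJ hK
      by_cases hJK : J ≤ K
      · refine LiftsAlong.of_bijective _ _ ⟨?_, ?_⟩
        · refine (injective_iff_map_eq_zero _).2 fun b hb => ?_
          obtain ⟨b, rfl⟩ := Ideal.Quotient.mk_surjective b
          exact Ideal.Quotient.eq_zero_iff_mem.2 (hJK hb)
        · intro a
          obtain ⟨b, rfl⟩ := hf a
          exact ⟨Ideal.Quotient.mk K b, rfl⟩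
      -- The class of `t` is a nonzero element of the socle of `B/K`, so `B/K → B/(K + (t))` is small.
      obtain ⟨t, htJ, htK, ht⟩ := IsLocalRing.exists_mem_socle_quotient hJK
      have hL : K ⊔ Ideal.span {t} ≤ J :=
        sup_le hK ((Ideal.span_singleton_le_iff_mem _).2 htJ)
      have hL1 := ne_top_of_le_ne_top hJ hL
      have hKL : K < K ⊔ Ideal.span {t} := left_lt_sup.2 fun h =>
        htK ((Ideal.span_singleton_le_iff_mem _).1 h)
      let π : B.quot K hK1 ⟶ B.quot (K ⊔ Ideal.span {t}) hL1 := Ideal.Quotient.factorₐ Λ hKL.le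
      have hπ : LiftsAlong φ π := by
        refine LiftsAlong.of_small hGs hGh hHh hG0 hφ π (t := Ideal.Quotient.mk K t)
          (Ideal.Quotient.factor_surjective hKL.le) ?_ ?_ ?_
        · refine le_antisymm (fun b hb => ?_) ?_
          · obtain ⟨b, rfl⟩ := Ideal.Quotient.mk_surjective b
            have hb' : b ∈ K ⊔ Ideal.span {t} := Ideal.Quotient.eq_zero_iff_mem.1 hb
            obtain ⟨y, hy, z, hz, rfl⟩ := Submodule.mem_sup.1 hb'
            obtain ⟨c, rfl⟩ := Ideal.mem_span_singleton'.1 hz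
            refine Ideal.mem_span_singleton'.2 ⟨Ideal.Quotient.mk K c, ?_⟩
            change _ = Ideal.Quotient.mk K (y + c * t)
            rw [map_add, Ideal.Quotient.eq_zero_iff_mem.2 hy, zero_add, map_mul]
            rfl
          · refine (Ideal.span_singleton_le_iff_mem _).2 ?_
            exact Ideal.Quotient.eq_zero_iff_mem.2
              (le_sup_right (a := K) (Ideal.mem_span_singleton_self t))
        · exact fun h => htK (Ideal.Quotient.eq_zero_iff_mem.1 h)
        · intro a ha
          obtain ⟨a, rfl⟩ := Ideal.Quotient.mk_surjective a
          have ha' : a ∈ IsLocalRing.maximalIdeal B := fun hu => ha (hu.map (Ideal.Quotient.mk K))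
          exact (map_mul (Ideal.Quotient.mk K) a t).symm.trans
            (Ideal.Quotient.eq_zero_iff_mem.2 (ht a ha'))
      have hcomp : π ≫ (Ideal.Quotient.liftₐ _ (ArtAlg.hom f) hL :
            B.quot (K ⊔ Ideal.span {t}) hL1 ⟶ A) =
          (Ideal.Quotient.liftₐ K (ArtAlg.hom f) hK : B.quot K hK1 ⟶ A) :=
        AlgHom.ext fun b => by
          obtain ⟨b, rfl⟩ := Ideal.Quotient.mk_surjective b
          rfl
      have := hπ.comp (ih _ hKL hL)
      rwa [hcomp] at this
  have hbot := ne_top_of_le_ne_top hJ bot_le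
  let ι : B ⟶ B.quot ⊥ hbot := Ideal.Quotient.mkₐ Λ ⊥
  have hι : LiftsAlong φ ι := LiftsAlong.of_bijective _ _
    ⟨(injective_iff_map_eq_zero _).2 fun _ hb => Ideal.Quotient.eq_zero_iff_mem.1 hb,
      Ideal.Quotient.mk_surjective⟩
  exact hι.comp (key ⊥ bot_le)

end Lifting

/-! ### The fibre of a morphism and its deformation groupoid -/

section Fibre

variable {Λ : Type u} [CommRing Λ] [IsLocalRing Λ] [IsNoetherianRing Λ]
  {E F : SDC.{u, w} Λ}

namespace PreSDC.Hom

variable {φ : E.Hom F.toPreSDC}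

theorem liftsAlong (hφ : ∀ n : ℕ, Function.Surjective (φ.tangentMap n)) (n : ℕ)
    {A B : ArtAlg Λ} (f : B ⟶ A) (hf : Function.Surjective (ArtAlg.hom f)) :
    LiftsAlong (φ.app n) f :=
  LiftsAlong.of_surjective (E.isSDC.smooth n) (E.isSDC.homogeneous n) (F.isSDC.homogeneous n)
    (E.isSDC.pointed n).subsingleton (hφ n) f hf

/-- Each `E^n(A) → F^n(A)` is onto, by lifting along `A → k`, over which both functors are a
point. -/
theorem app_surjective (hφ : ∀ n : ℕ, Function.Surjective (φ.tangentMap n)) (n : ℕ)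
    (A : ArtAlg Λ) : Function.Surjective ((φ.app n).app A) := by
  intro h
  have := (F.isSDC.pointed n).subsingleton
  obtain ⟨_⟩ := E.isSDC.pointed n
  obtain ⟨g, -, hg⟩ := liftsAlong hφ n A.toResidueField
    (ArtAlg.hom_residueField_surjective _) default h (Subsingleton.elim _ _)
  exact ⟨g, hg⟩

/-- Lifting along surjections with the element of `F^n` prescribed to be `x^n` gives smoothness of
the fibre. Homogeneity uses uniqueness of gluing in `F^n` to see that glued elements stay over
`x^n`. The identities are those of `E`. -/
theorem isSDC_fibre (hφ : ∀ n : ℕ, Function.Surjective (φ.tangentMap n))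
    (x : ProLimit F.mc) : IsSDC (fibre φ x) where
  pointed n := by
    obtain ⟨_⟩ := E.isSDC.pointed n
    have := (F.isSDC.pointed n).subsingleton
    exact ⟨{ default := ⟨default, Subsingleton.elim _ _⟩
             uniq := fun e => Subtype.ext (Unique.eq_default e.1) }⟩
  smooth n B A f hf := by
    rintro ⟨a, ha⟩
    obtain ⟨b, hb, hb'⟩ := liftsAlong hφ n f hf a (F.pow (PreSDC.mcAt x B) n) (by
      rw [F.map_pow, PreSDC.map_mcAt, ha])
    exact ⟨⟨b, hb'⟩, Subtype.ext hb⟩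
  homogeneous n A B C f g hf := by
    constructor
    · intro p q h
      refine Subtype.ext ((E.isSDC.homogeneous n).ext hf ?_ ?_)
      · exact congrArg (fun r => r.1.1.1) h
      · exact congrArg (fun r => r.1.2.1) h
    · rintro ⟨⟨b, c⟩, h⟩
      obtain ⟨p, hp1, hp2⟩ := (E.isSDC.homogeneous n).exists_glue hf b.1 c.1
        (congrArg Subtype.val h)
      have hp : (φ.app n).app _ p = F.pow (PreSDC.mcAt x (ArtAlg.pullback f g)) n := by
        refine (F.isSDC.homogeneous n).ext hf ?_ ?_
        · rw [← NatTrans.naturality_apply, hp1, F.map_pow, PreSDC.map_mcAt, b.2]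
        · rw [← NatTrans.naturality_apply, hp2, F.map_pow, PreSDC.map_mcAt, c.2]
      exact ⟨⟨p, hp⟩, Subtype.ext (Prod.ext (Subtype.ext hp1) (Subtype.ext hp2))⟩
  mul_assoc h1 h2 h3 h4 _ a b c := Subtype.ext (E.isSDC.mul_assoc h1 h2 h3 h4 a.1 b.1 c.1)
  one_mul h _ e := Subtype.ext (E.isSDC.one_mul h e.1)
  mul_one h _ e := Subtype.ext (E.isSDC.mul_one h e.1)
  d_d hi hij hj _ e := Subtype.ext (E.isSDC.d_d hi hij hj e.1)
  s_s hij hj _ e := Subtype.ext (E.isSDC.s_s hij hj e.1)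
  s_d_lt hi hij hj _ e := Subtype.ext (E.isSDC.s_d_lt hi hij hj e.1)
  s_d_eq hi hn hij _ e := Subtype.ext (E.isSDC.s_d_eq hi hn hij e.1)
  s_d_gt hij hi _ e := Subtype.ext (E.isSDC.s_d_gt hij hi e.1)
  d_mul hi hm h _ e f := Subtype.ext (E.isSDC.d_mul hi hm h e.1 f.1)
  mul_d hi hn h _ e f := Subtype.ext (E.isSDC.mul_d hi hn h e.1 f.1)
  s_mul hi h _ e f := Subtype.ext (E.isSDC.s_mul hi h e.1 f.1)
  mul_s hi h _ e f := Subtype.ext (E.isSDC.mul_s hi h e.1 f.1)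

end PreSDC.Hom

/-- The gauge action preserves the Maurer–Cartan equation: both sides of it are conjugated
by `g`. -/
theorem SDC.isMC_conj (E : SDC.{u, w} Λ) {A : ArtAlg Λ} (g : (E.obj 0).obj A)
    {ω : (E.obj 1).obj A} (hω : E.IsMC ω) : E.IsMC (E.conj g ω) := by
  have S := E.isSDC
  let gω : (E.obj 1).obj A := E.mul (rfl : 0 + 1 = 1) g ω
  -- `g⁻¹ * (g * ω * g⁻¹) = ω * g⁻¹`
  have e1 : E.mul (rfl : 0 + 1 = 1) g⁻¹ (E.conj g ω) = E.mul (rfl : 1 + 0 = 1) ω g⁻¹ := by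
    rw [SDC.conj, ← S.mul_assoc (rfl : 0 + 1 = 1) (rfl : 1 + 0 = 1) rfl rfl,
      ← S.mul_assoc (rfl : 0 + 0 = 0) (rfl : 0 + 1 = 1) rfl rfl, E.mul_def, inv_mul_cancel]
    congr 1
    exact S.one_mul _ _
  have e2 : E.mul (rfl : 1 + 1 = 1 + 1) (E.conj g ω) (E.conj g ω) =
      E.mul (rfl : 0 + 2 = 2) g
        (E.mul (rfl : 2 + 0 = 2) (E.mul (rfl : 1 + 1 = 1 + 1) ω ω) g⁻¹) := by
    calc E.mul (rfl : 1 + 1 = 1 + 1) (E.conj g ω) (E.conj g ω)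
        = E.mul (rfl : 1 + 1 = 1 + 1) gω (E.mul (rfl : 0 + 1 = 1) g⁻¹ (E.conj g ω)) :=
          S.mul_assoc _ _ _ _ _ _ _
      _ = E.mul (rfl : 1 + 1 = 1 + 1) gω (E.mul (rfl : 1 + 0 = 1) ω g⁻¹) := by rw [e1]
      _ = E.mul (rfl : 0 + 2 = 2) g
            (E.mul (rfl : 1 + 1 = 1 + 1) ω (E.mul (rfl : 1 + 0 = 1) ω g⁻¹)) :=
          S.mul_assoc _ _ _ _ _ _ _
      _ = _ := congrArg _ (S.mul_assoc _ _ _ _ _ _ _).symm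
  have e3 : (E.d 1 1 le_rfl le_rfl).app A (E.conj g ω) =
      E.mul (rfl : 0 + 2 = 2) g
        (E.mul (rfl : 2 + 0 = 2) ((E.d 1 1 le_rfl le_rfl).app A ω) g⁻¹) := by
    have h1 := S.d_mul (m := 1) (n := 0) (p := 1) (i := 1) le_rfl le_rfl rfl gω g⁻¹
    have h2 := S.mul_d (m := 0) (n := 1) (p := 1) (i := 1) le_rfl le_rfl rfl g ω
    exact (h1.symm.trans (congrArg (fun z => E.mul (rfl : 2 + 0 = 2) z g⁻¹) h2.symm)).trans
      (S.mul_assoc _ _ _ _ _ _ _)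
  rw [PreSDC.IsMC, e2, e3, hω]

/-- The comparison functor is faithful by construction, full because gauges over `1` are those of
the fibre, and essentially surjective because `φ` is onto in degree `0`. -/
theorem comparison_isEquivalence {φ : E.Hom F.toPreSDC}
    (hφ : ∀ n : ℕ, Function.Surjective (φ.tangentMap n)) (x : ProLimit F.mc)
    (h : IsSDC (fibre φ x)) (A : ArtAlg Λ) : CategoryTheory.Functor.IsEquivalence
      (C := DefObj (fibreSDC φ x h) A) (D := DefFibreObj φ x A)
      ((comparison φ x h).app A) := by
  let Φ : DefObj (fibreSDC φ x h) A ⥤ DefFibreObj φ x A := (comparison φ x h).app A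
  change Φ.IsEquivalence
  refine
    { faithful := ⟨fun {X Y g g'} hg => Subtype.ext (Subtype.ext ?_)⟩
      full := ⟨fun {X Y} g => ?_⟩
      essSurj := ⟨fun Y => ?_⟩ }
  · have h1 : (Φ.map g).1 = (Φ.map g').1 := by rw [hg]
    exact h1
  -- A morphism `(ω, 1) → (ω', 1)` is a `g` with `φ(g) = 1`, that is, an element of the fibre.
  · have h1 : SDC.homGauge φ A g.1 = 1 := by
      have := g.2.2
      change 1 * (SDC.homGauge φ A g.1)⁻¹ = 1 at this
      rwa [one_mul, inv_eq_one] at this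
    let g' : ((fibreSDC φ x h).obj 0).obj A := ⟨g.1, h1⟩
    have h2 : (fibreSDC φ x h).conj g' X.point = Y.point := Subtype.ext
      ((SDC.hom_conj (E := fibreSDC φ x h) (F := E) (fibreIncl φ x) g' X.point).trans g.2.1)
    exact ⟨⟨g', h2⟩, rfl⟩
  -- Lifting `h` to `g ∈ E⁰(A)` gives an isomorphism `g : (ω, h) → (g ω g⁻¹, 1)`.
  · obtain ⟨g, hg⟩ := PreSDC.Hom.app_surjective hφ 0 A Y.path
    have hg' : SDC.homGauge φ A g = Y.path := hg
    have hfib : (φ.app 1).app A (E.conj g Y.point) = F.pow (PreSDC.mcAt x A) 1 := by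
      rw [SDC.hom_conj, hg', Y.conj_path]
      exact (F.isSDC.one_mul _ _).symm
    let X : DefObj (fibreSDC φ x h) A :=
      ⟨⟨E.conj g Y.point, hfib⟩, Subtype.ext (E.isMC_conj g Y.isMC)⟩
    let γ : Y ⟶ Φ.obj X := ⟨g, rfl, by rw [hg', mul_inv_cancel]; rfl⟩
    exact ⟨X, ⟨(asIso γ).symm⟩⟩

end Fibre

theorem mainTheorem8 {Λ : Type u} [CommRing Λ] [IsLocalRing Λ] [IsNoetherianRing Λ]
    [IsAdicComplete (IsLocalRing.maximalIdeal Λ) Λ]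
    (E F : SDC.{u, w} Λ) (φ : E.Hom F.toPreSDC)
    (hφ : ∀ n : ℕ, Function.Surjective (φ.tangentMap n))
    (x : ProLimit F.mc) :
    ∃ h : IsSDC (fibre φ x),
      ∀ A : ArtAlg Λ, CategoryTheory.Functor.IsEquivalence
        (C := DefObj (fibreSDC φ x h) A) (D := DefFibreObj φ x A)
        ((comparison φ x h).app A) :=
  ⟨PreSDC.Hom.isSDC_fibre hφ x, comparison_isEquivalence hφ x _⟩
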